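/- **Conventions.** Fix a commutative ring $k$. A *graded ring* is a $\mathbb{Z}$-graded (associative, unital) $k$-algebra $R=\bigoplus_{i\in\mathbb{Z}}R_i$. Modules are right modules. For a graded ring $R$, $\mathrm{gr}\text{-}R$ is the $k$-linear category of $\mathbb{Z}$-graded right $R$-modules, with the degree-preserving $R$-module homomorphisms as morphisms; write $\hom_R$ for its Hom-modules. All equivalences of categories are $k$-linear. $\mathrm{Pic}(\mathrm{gr}\text{-}R)$ is the group of autoequivalences of $\mathrm{gr}\text{-}R$ modulo natural isomorphism, under composition. For an autoequivalence $\mathcal F$ of $\mathrm{gr}\text{-}R$ put $\mathcal F^0=\mathrm{id}$, and for $n>0$ let $\mathcal F^{-n}$ be the $n$-th power of a quasi-inverse of $\mathcal F$. If $P$ is a finitely generated graded projective $R$-module, $\mathcal F$ is called *$P$-generative* if the modules $\{\mathcal F^iP\}_{i\in\mathbb{Z}}$ generate $\mathrm{gr}\text{-}R$. A *$\mathbb{Z}$-sequence for $\mathcal F$* is a family $(\mathcal F_i)_{i\in\mathbb{Z}}$ of $k$-linear autoequivalences of $\mathrm{gr}\text{-}R$ with $\mathcal F_1\cong\mathcal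 F$, together with natural isomorphisms $\varepsilon:\mathcal F_0\to\mathrm{id}$ and $\eta^{ij}:\mathcal F_{i+j}\to\mathcal F_i\mathcal F_j$ such that $\varepsilon_{\mathcal F_j}\circ\eta^{0j}=\mathrm{id}=\mathcal F_j(\varepsilon)\circ\eta^{j0}$ and $\mathcal F_i(\eta^{jl})\circ\eta^{i,j+l}=\eta^{ij}_{\mathcal F_l}\circ\eta^{i+j,l}$ for all $i,j,l$. (The powers $(\mathcal F^i)_{i\in\mathbb{Z}}$ are an example.) The *twisted endomorphism ring* of $P$ is the graded ring $$\mathrm{End}^{\mathcal F}_R(P)=\bigoplus_{n\in\mathbb{Z}}\hom_R(\mathcal F_nP,P),$$ with unit $\varepsilon_P$ and with product $a\star b=a\circ\mathcal F_i(b)\circ\eta^{ij}_P$ for $a\in\hom_R(\mathcal F_iP,P)$ and $b\in\hom_R(\mathcal F_jP,P)$. Two graded rings $T$ and $S$ are *graded Morita equivalent* if there is a graded right $T$-module $Q$ that is a progenerator (a finitely generated projective generator) of the category of all right $T$-modules, such that $S\cong\mathrm{End}_T(Q)$ as graded $k$-algebras, where the component of degree $n$ of $\mathrm{End}_T(Q)$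 consists of the endomorphisms mapping $Q_i$ into $Q_{i+n}$ for all $i$. **Proposition.** Let $R$ be a graded ring, let $P$ and $P'$ be finitely generated graded projective $R$-modules, and let $\mathcal F$ and $\mathcal F'$ be autoequivalences of $\mathrm{gr}\text{-}R$ such that $\mathcal F$ is $P$-generative and $\mathcal F'$ is $P'$-generative. Then, for any $\mathbb{Z}$-sequences for $\mathcal F$ and $\mathcal F'$ used to form the twisted endomorphism rings, $\mathrm{End}^{\mathcal F}_R(P)$ and $\mathrm{End}^{\mathcal F'}_R(P')$ are graded Morita equivalent if and only if $\mathcal F$ and $\mathcal F'$ are conjugate in $\mathrm{Pic}(\mathrm{gr}\text{-}R)$. -/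

import Mathlib

open CategoryTheory DirectSum

universe w v u

/-! ### Graded right modules -/

section GradedModules

/-- A `ℤ`-graded right module over the `ℤ`-graded `k`-algebra `R = ⨁ i, 𝒜 i`. Right `R`-modules
are modules over the opposite ring `Rᵐᵒᵖ`, so `m · r` is `MulOpposite.op r • m`. The `k`-module
structure is the one induced by `R` (`IsScalarTower`). -/
structure GrMod {k : Type w} [CommRing k] {R : Type u} [Ring R] [Algebra k R]
    (𝒜 : ℤ → Submodule k R) where
  carrier : Type u
  [addCommGroup : AddCommGroup carrier]
  [moduleBase : Module k carrier]
  [module : Module Rᵐᵒᵖ carrier]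
  [isScalarTower : IsScalarTower k Rᵐᵒᵖ carrier]
  /-- the homogeneous components -/
  deg : ℤ → Submodule k carrier
  isInternal : DirectSum.IsInternal deg
  smul_mem : ∀ (i j : ℤ) (m : carrier) (r : R), m ∈ deg i → r ∈ 𝒜 j →
    MulOpposite.op r • m ∈ deg (i + j)

namespace GrMod

attribute [instance] GrMod.addCommGroup GrMod.moduleBase GrMod.module GrMod.isScalarTower

variable {k : Type w} [CommRing k] {R : Type u} [Ring R] [Algebra k R] {𝒜 : ℤ → Submodule k R}

/-- The `R`-linear maps `M → N` that send `M_i` into `N_{i + n}` for all `i`. -/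
def homDeg (M N : GrMod 𝒜) (n : ℤ) : Submodule k (M.carrier →ₗ[Rᵐᵒᵖ] N.carrier) where
  carrier := {f | ∀ i, ∀ m ∈ M.deg i, f m ∈ N.deg (i + n)}
  zero_mem' := fun i _ _ => (N.deg (i + n)).zero_mem
  add_mem' := fun hf hg i m hm => (N.deg (i + n)).add_mem (hf i m hm) (hg i m hm)
  smul_mem' := fun c _ hf i m hm => (N.deg (i + n)).smul_mem c (hf i m hm)

/-- The morphisms of the category of graded right modules: `R`-linear maps that fix degree. -/
def homSubmodule (M N : GrMod 𝒜) : Submodule k (M.carrier →ₗ[Rᵐᵒᵖ] N.carrier) where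
  carrier := {f | ∀ i, ∀ m ∈ M.deg i, f m ∈ N.deg i}
  zero_mem' := fun i _ _ => (N.deg i).zero_mem
  add_mem' := fun hf hg i m hm => (N.deg i).add_mem (hf i m hm) (hg i m hm)
  smul_mem' := fun c _ hf i m hm => (N.deg i).smul_mem c (hf i m hm)

/-- The category `gr-R` of graded right `R`-modules. -/
instance : Category.{u} (GrMod 𝒜) where
  Hom M N := homSubmodule M N
  id M := ⟨LinearMap.id, fun _ _ hm => hm⟩
  comp f g := ⟨g.1.comp f.1, fun i m hm => g.2 i _ (f.2 i m hm)⟩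

instance (M N : GrMod 𝒜) : AddCommGroup (M ⟶ N) :=
  inferInstanceAs (AddCommGroup (homSubmodule M N))

instance : Preadditive (GrMod 𝒜) where
  add_comp _ _ _ f f' g := Subtype.ext (LinearMap.comp_add f.1 f'.1 g.1)
  comp_add _ _ _ f g g' := Subtype.ext (LinearMap.add_comp f.1 g'.1 g.1)

/-- `gr-R` is a `k`-linear category. -/
instance : Linear k (GrMod 𝒜) where
  homModule M N := inferInstanceAs (Module k (homSubmodule M N))
  smul_comp _ _ _ c f g := Subtype.ext (by
    ext m
    exact LinearMap.map_smul_of_tower g.1 c (f.1 m))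
  comp_smul _ _ _ f c g := Subtype.ext (LinearMap.smul_comp c g.1 f.1)

end GrMod

/-- Two `ℤ`-graded `k`-algebras `T` and `S` are graded Morita equivalent: there is a graded right
`T`-module `Q` that is a progenerator (a finitely generated projective generator) of the category
of all right `T`-modules, such that `S` is isomorphic, as a graded `k`-algebra, to the endomorphism
ring `End_T(Q)`, whose component of degree `n` consists of the endomorphisms of degree `n`. -/
def IsGradedMoritaEquivalent {k : Type w} [CommRing k] {T S : Type u} [Ring T] [Ring S]
    [Algebra k T] [Algebra k S] (𝒯 : ℤ → Submodule k T) (𝒮 : ℤ → Submodule k S) : Prop :=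
  ∃ Q : GrMod 𝒯, Module.Finite Tᵐᵒᵖ Q.carrier ∧ Module.Projective Tᵐᵒᵖ Q.carrier ∧
    IsSeparator (ModuleCat.of.{u} Tᵐᵒᵖ Q.carrier) ∧
    ∃ e : S ≃ₐ[k] Module.End Tᵐᵒᵖ Q.carrier,
      ∀ (n : ℤ) (s : S), s ∈ 𝒮 n ↔ e s ∈ GrMod.homDeg Q Q n

end GradedModules

/-! ### Autoequivalences and the Picard group -/

section Picard

/-- A `k`-linear autoequivalence of a `k`-linear category. -/
structure Autoequivalence (k : Type w) [CommRing k] (C : Type u) [Category.{v} C] [Preadditive C]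
    [Linear k C] where
  functor : C ⥤ C
  [isEquivalence : functor.IsEquivalence]
  [additive : functor.Additive]
  [linear : functor.Linear k]

namespace Autoequivalence

attribute [instance] Autoequivalence.isEquivalence Autoequivalence.additive Autoequivalence.linear

variable {k : Type w} [CommRing k] {C : Type u} [Category.{v} C] [Preadditive C] [Linear k C]

instance inv_additive (F : Autoequivalence k C) : F.functor.inv.Additive :=
  have : F.functor.asEquivalence.functor.Additive := F.additive
  F.functor.asEquivalence.inverse_additive

instance inv_linear (F : Autoequivalence k C) : F.functor.inv.Linear k :=
  have : F.functor.asEquivalence.functor.Linear k := F.linear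
  F.functor.asEquivalence.inverseLinear k

/-- The identity autoequivalence. -/
protected def refl : Autoequivalence k C where
  functor := 𝟭 C

/-- The composition `F ∘ G` of autoequivalences, `X ↦ F (G X)`. -/
protected def comp (F G : Autoequivalence k C) : Autoequivalence k C where
  functor := G.functor ⋙ F.functor

/-- A quasi-inverse of an autoequivalence. -/
protected noncomputable def symm (F : Autoequivalence k C) : Autoequivalence k C where
  functor := F.functor.inv

/-- Two autoequivalences are identified if they are naturally isomorphic. -/
instance setoid (k : Type w) [CommRing k] (C : Type u) [Category.{v} C] [Preadditive C]
    [Linear k C] : Setoid (Autoequivalence k C) where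
  r F G := Nonempty (F.functor ≅ G.functor)
  iseqv :=
    { refl := fun _ => ⟨Iso.refl _⟩
      symm := fun ⟨a⟩ => ⟨a.symm⟩
      trans := fun ⟨a⟩ ⟨b⟩ => ⟨a.trans b⟩ }

end Autoequivalence

/-- The Picard group of a `k`-linear category: the `k`-linear autoequivalences modulo natural
isomorphism, with composition. -/
def Pic (k : Type w) [CommRing k] (C : Type u) [Category.{v} C] [Preadditive C] [Linear k C] :=
  Quotient (Autoequivalence.setoid k C)

namespace Pic

variable {k : Type w} [CommRing k] {C : Type u} [Category.{v} C] [Preadditive C] [Linear k C]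

/-- The class of an autoequivalence in the Picard group. -/
def mk (F : Autoequivalence k C) : Pic k C := Quotient.mk _ F

noncomputable instance : Group (Pic k C) where
  mul := Quotient.map₂ Autoequivalence.comp
    (fun _ _ ⟨a⟩ _ _ ⟨b⟩ => ⟨Functor.isoWhiskerRight b _ ≪≫ Functor.isoWhiskerLeft _ a⟩)
  one := mk Autoequivalence.refl
  inv := Quotient.map Autoequivalence.symm (fun F G ⟨a⟩ =>
    ⟨(Functor.leftUnitor _).symm ≪≫
      Functor.isoWhiskerRight G.functor.asEquivalence.counitIso.symm F.functor.inv ≪≫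
      Functor.associator _ _ _ ≪≫
      Functor.isoWhiskerLeft G.functor.inv (Functor.isoWhiskerRight a.symm F.functor.inv ≪≫
        F.functor.asEquivalence.unitIso.symm) ≪≫ Functor.rightUnitor _⟩)
  mul_assoc := by
    rintro ⟨F⟩ ⟨G⟩ ⟨H⟩
    exact Quotient.sound ⟨(Functor.associator H.functor G.functor F.functor).symm⟩
  one_mul := by
    rintro ⟨F⟩
    exact Quotient.sound ⟨Functor.rightUnitor F.functor⟩
  mul_one := by
    rintro ⟨F⟩
    exact Quotient.sound ⟨Functor.leftUnitor F.functor⟩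
  inv_mul_cancel := by
    rintro ⟨F⟩
    exact Quotient.sound ⟨F.functor.asEquivalence.unitIso.symm⟩

end Pic

end Picard

/-! ### `ℤ`-sequences of autoequivalences -/

section Sequences

/-- A `ℤ`-sequence `(F_i)` of `k`-linear functors with `F_1 ≅ F`: one has `F_0 ≅ id` and natural
compatibility isomorphisms `η i j : F_{i + j} ≅ F_i ∘ F_j` that are unital and associative. The
index `l` of `η i j l` stands for `i + j`. (Each `F_i` is an equivalence with quasi-inverse
`F_{-i}`.) -/
structure ZSequence {k : Type w} [CommRing k] {C : Type u} [Category.{v} C] [Preadditive C]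
    [Linear k C] (F : Autoequivalence k C) where
  functor : ℤ → (C ⥤ C)
  additive : ∀ i, (functor i).Additive
  linear : ∀ i, (functor i).Linear k
  one : Nonempty (functor 1 ≅ F.functor)
  zero : functor 0 ≅ 𝟭 C
  η : ∀ i j l : ℤ, i + j = l → (functor l ≅ functor j ⋙ functor i)
  η_zero_left : ∀ (j : ℤ) (X : C),
    (η 0 j j (zero_add j)).hom.app X ≫ zero.hom.app ((functor j).obj X) = 𝟙 ((functor j).obj X)
  η_zero_right : ∀ (i : ℤ) (X : C),
    (η i 0 i (add_zero i)).hom.app X ≫ (functor i).map (zero.hom.app X) = 𝟙 ((functor i).obj X)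
  η_assoc : ∀ (i j l ij jl ijl : ℤ) (h₁ : i + j = ij) (h₂ : j + l = jl) (h₃ : i + jl = ijl)
    (h₄ : ij + l = ijl) (X : C),
    (η i jl ijl h₃).hom.app X ≫ (functor i).map ((η j l jl h₂).hom.app X) =
      (η ij l ijl h₄).hom.app X ≫ (η i j ij h₁).hom.app ((functor l).obj X)

/-- A sequence of objects `A_n` of a category with isomorphisms `W A_n ≅ A_{n+1}`. -/
structure ZChain {D : Type u} [Category.{v} D] (W : D ⥤ D) where
  obj : ℤ → D
  step : ∀ n m : ℤ, n + 1 = m → (W.obj (obj n) ≅ obj m)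

namespace ZChain

variable {D : Type u} [Category.{v} D] {W : D ⥤ D}

/-- Families of morphisms between two chains that are compatible with the steps. -/
def Compat (A B : ZChain W) (f : ∀ n, A.obj n ⟶ B.obj n) : Prop :=
  ∀ n m (h : n + 1 = m), W.map (f n) ≫ (B.step n m h).hom = (A.step n m h).hom ≫ f m

theorem Compat.ext [W.Faithful] {A B : ZChain W} {f g : ∀ n, A.obj n ⟶ B.obj n}
    (hf : A.Compat B f) (hg : A.Compat B g) (h0 : f 0 = g 0) (n : ℤ) : f n = g n := by
  induction n with
  | zero => exact h0
  | succ i ih =>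
    have h1 := hf i (i + 1) rfl
    have h2 := hg i (i + 1) rfl
    rw [ih, h2] at h1
    exact ((cancel_epi _).1 h1).symm
  | pred i ih =>
    have h1 := hf (-i - 1) (-i) (by ring)
    have h2 := hg (-i - 1) (-i) (by ring)
    rw [ih, ← h2] at h1
    exact W.map_injective ((cancel_mono _).1 h1)

section

variable (hW : W.FullyFaithful) (A B : ZChain W) (θ : A.obj 0 ≅ B.obj 0)

/-- The extension of an isomorphism `A_0 ≅ B_0` to nonnegative indices. -/
def isoNat : ∀ n : ℕ, A.obj n ≅ B.obj n
  | 0 => θ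
  | n + 1 => (A.step n (n + 1 : ℕ) (by push_cast; rfl)).symm ≪≫ W.mapIso (isoNat n) ≪≫
      B.step n (n + 1 : ℕ) (by push_cast; rfl)

/-- The extension of an isomorphism `A_0 ≅ B_0` to nonpositive indices. -/
def isoNeg : ∀ n : ℕ, A.obj (-n) ≅ B.obj (-n)
  | 0 => θ
  | n + 1 => hW.preimageIso (A.step (-(n + 1 : ℕ)) (-n) (by push_cast; ring) ≪≫ isoNeg n ≪≫
      (B.step (-(n + 1 : ℕ)) (-n) (by push_cast; ring)).symm)

/-- The unique compatible extension of an isomorphism `A_0 ≅ B_0` to all indices. -/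
def iso : ∀ n : ℤ, A.obj n ≅ B.obj n
  | .ofNat n => isoNat A B θ n
  | .negSucc n => isoNeg hW A B θ (n + 1)

theorem iso_zero : iso hW A B θ 0 = θ := rfl

theorem iso_compat : A.Compat B (fun n => (iso hW A B θ n).hom) := by
  rintro (n | n) m h
  · obtain rfl : m = ((n + 1 : ℕ) : ℤ) := by rw [← h]; rfl
    change W.map (isoNat A B θ n).hom ≫ _ = _ ≫ (isoNat A B θ (n + 1)).hom
    simp only [isoNat, Iso.trans_hom, Iso.symm_hom, Functor.mapIso_hom]
    exact (Iso.hom_inv_id_assoc _ _).symm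
  · obtain rfl : m = -(n : ℤ) := by rw [← h, Int.negSucc_eq]; ring
    have key : (iso hW A B θ (-(n : ℤ))) = isoNeg hW A B θ n := by
      cases n <;> rfl
    dsimp only
    rw [key]
    change W.map (isoNeg hW A B θ (n + 1)).hom ≫ _ = _ ≫ (isoNeg hW A B θ n).hom
    simp only [isoNeg, Functor.FullyFaithful.preimageIso_hom, Functor.FullyFaithful.map_preimage,
      Iso.trans_hom, Iso.symm_hom, Category.assoc]
    erw [Iso.inv_hom_id, Category.comp_id]
    rfl

end

end ZChain

namespace Autoequivalence

variable {k : Type w} [CommRing k] {C : Type u} [Category.{v} C] [Preadditive C] [Linear k C]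

/-- The `n`-fold composition of a functor with itself. -/
def npow (F : C ⥤ C) : ℕ → (C ⥤ C)
  | 0 => 𝟭 C
  | n + 1 => npow F n ⋙ F

/-- The powers `F^n`, where `F^{-n}` is the `n`-th power of a quasi-inverse of `F`. -/
noncomputable def zpow (F : Autoequivalence k C) : ℤ → (C ⥤ C)
  | .ofNat n => npow F.functor n
  | .negSucc n => npow F.functor.inv (n + 1)

/-- The natural isomorphism `F ∘ F^n ≅ F^{n + 1}`. -/
noncomputable def zpowStep (F : Autoequivalence k C) :
    ∀ n m : ℤ, n + 1 = m → (F.zpow n ⋙ F.functor ≅ F.zpow m)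
  | .ofNat n, m, h => eqToIso (by subst h; rfl)
  | .negSucc n, m, h =>
      Functor.associator (npow F.functor.inv n) F.functor.inv F.functor ≪≫
        Functor.isoWhiskerLeft (npow F.functor.inv n) F.functor.asEquivalence.counitIso ≪≫
        Functor.rightUnitor _ ≪≫ eqToIso (by
          obtain rfl : m = -(n : ℤ) := by rw [← h, Int.negSucc_eq]; ring
          cases n <;> rfl)

/-- The functor `G ↦ F ∘ G`. -/
abbrev postcomp (F : Autoequivalence k C) : (C ⥤ C) ⥤ (C ⥤ C) :=
  (Functor.whiskeringRight C C C).obj F.functor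

/-- Composition with an equivalence is fully faithful. -/
noncomputable def postcompFullyFaithful (F : Autoequivalence k C) : F.postcomp.FullyFaithful :=
  (Functor.FullyFaithful.ofFullyFaithful F.functor).whiskeringRight C

/-- The chain `n ↦ F^{n + j}`. -/
noncomputable def shiftChain (F : Autoequivalence k C) (j : ℤ) : ZChain F.postcomp where
  obj n := F.zpow (n + j)
  step n m h := F.zpowStep (n + j) (m + j) (by rw [← h]; ring)

/-- The chain `n ↦ F^n ∘ G`. -/
noncomputable def compChain (F : Autoequivalence k C) (G : C ⥤ C) : ZChain F.postcomp where
  obj n := G ⋙ F.zpow n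
  step n m h := Functor.isoWhiskerLeft G (F.zpowStep n m h)

/-- The compatibility isomorphisms `F^{i + j} ≅ F^i ∘ F^j`: the only ones that respect the
isomorphisms `F ∘ F^n ≅ F^{n + 1}` and are the identity for `i = 0`. -/
noncomputable def zpowAdd (F : Autoequivalence k C) (i j l : ℤ) (h : i + j = l) :
    F.zpow l ≅ F.zpow j ⋙ F.zpow i :=
  eqToIso (congrArg F.zpow h.symm) ≪≫ ZChain.iso F.postcompFullyFaithful (F.shiftChain j)
    (F.compChain (F.zpow j)) (eqToIso (congrArg F.zpow (zero_add j))) i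

theorem zpowAdd_zero (F : Autoequivalence k C) (j : ℤ) :
    (F.zpowAdd 0 j j (zero_add j)).hom = 𝟙 (F.zpow j) := by
  unfold zpowAdd
  rw [ZChain.iso_zero]
  exact eqToHom_trans (congrArg F.zpow (zero_add j).symm) (congrArg F.zpow (zero_add j))

theorem zpowAdd_step (F : Autoequivalence k C) (i i' j l l' : ℤ) (h : i + j = l)
    (hi : i + 1 = i') (hl : l + 1 = l') :
    Functor.whiskerRight (F.zpowAdd i j l h).hom F.functor ≫
        Functor.whiskerLeft (F.zpow j) (F.zpowStep i i' hi).hom =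
      (F.zpowStep l l' hl).hom ≫ (F.zpowAdd i' j l' (by rw [← hi, ← hl, ← h]; ring)).hom := by
  subst h
  obtain rfl : l' = i' + j := by rw [← hl, ← hi]; ring
  have := ZChain.iso_compat F.postcompFullyFaithful (F.shiftChain j)
    (F.compChain (F.zpow j)) (eqToIso (congrArg F.zpow (zero_add j))) i i' hi
  have e : ∀ i : ℤ, (F.zpowAdd i j (i + j) rfl).hom =
      (ZChain.iso F.postcompFullyFaithful (F.shiftChain j)
        (F.compChain (F.zpow j)) (eqToIso (congrArg F.zpow (zero_add j))) i).hom :=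
    fun i => Category.id_comp _
  rw [e, e]
  exact this

instance (F : Autoequivalence k C) : F.postcomp.Faithful := F.postcompFullyFaithful.faithful

theorem zpowAdd_assoc_zero (F : Autoequivalence k C) (j l ij jl ijl : ℤ) (h₁ : 0 + j = ij)
    (h₂ : j + l = jl) (h₃ : 0 + jl = ijl) (h₄ : ij + l = ijl) :
    (F.zpowAdd 0 jl ijl h₃).hom ≫ Functor.whiskerRight (F.zpowAdd j l jl h₂).hom (F.zpow 0) =
      (F.zpowAdd ij l ijl h₄).hom ≫ Functor.whiskerLeft (F.zpow l) (F.zpowAdd 0 j ij h₁).hom := by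
  obtain rfl : ij = j := h₁.symm.trans (zero_add j)
  obtain rfl : ijl = jl := h₃.symm.trans (zero_add jl)
  rw [F.zpowAdd_zero, F.zpowAdd_zero]
  exact (Category.id_comp _).trans (Category.comp_id (F.zpowAdd ij l ijl h₂).hom).symm

theorem zpowAdd_assoc (F : Autoequivalence k C) (i j l ij jl ijl : ℤ) (h₁ : i + j = ij)
    (h₂ : j + l = jl) (h₃ : i + jl = ijl) (h₄ : ij + l = ijl) :
    (F.zpowAdd i jl ijl h₃).hom ≫ Functor.whiskerRight (F.zpowAdd j l jl h₂).hom (F.zpow i) =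
      (F.zpowAdd ij l ijl h₄).hom ≫ Functor.whiskerLeft (F.zpow l) (F.zpowAdd i j ij h₁).hom := by
  subst h₁ h₂
  obtain rfl : ijl = i + (j + l) := h₃.symm
  refine ZChain.Compat.ext (A := F.shiftChain (j + l)) (B := F.compChain (F.zpow l ⋙ F.zpow j))
    (f := fun i => (F.zpowAdd i (j + l) (i + (j + l)) rfl).hom ≫
      Functor.whiskerRight (F.zpowAdd j l (j + l) rfl).hom (F.zpow i))
    (g := fun i => (F.zpowAdd (i + j) l (i + (j + l)) (add_assoc i j l)).hom ≫
      Functor.whiskerLeft (F.zpow l) (F.zpowAdd i j (i + j) rfl).hom) ?_ ?_ ?_ i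
  · intro n m h
    have h₁ := F.zpowAdd_step n m (j + l) (n + (j + l)) (m + (j + l)) rfl h (by rw [← h]; ring)
    ext X
    have h₁' := congrArg (fun α => α.app X) h₁
    have h₂ := (F.zpowStep n m h).hom.naturality ((F.zpowAdd j l (j + l) rfl).hom.app X)
    dsimp [compChain, shiftChain] at h₁' h₂ ⊢
    rw [Functor.map_comp, Category.assoc, h₂, reassoc_of% h₁']
  · intro n m h
    have h₁ := F.zpowAdd_step (n + j) (m + j) l (n + (j + l)) (m + (j + l)) (add_assoc n j l)
      (by rw [← h]; ring) (by rw [← h]; ring)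
    have h₂ := F.zpowAdd_step n m j (n + j) (m + j) rfl h (by rw [← h]; ring)
    ext X
    have h₁' := congrArg (fun α => α.app X) h₁
    have h₂' := congrArg (fun α => α.app ((F.zpow l).obj X)) h₂
    dsimp [compChain, shiftChain] at h₁' h₂' ⊢
    rw [Functor.map_comp, Category.assoc, h₂', reassoc_of% h₁']
  · exact F.zpowAdd_assoc_zero j l _ _ _ rfl rfl rfl (add_assoc 0 j l)

theorem zpowAdd_right_zero (F : Autoequivalence k C) (i : ℤ) :
    (F.zpowAdd i 0 i (add_zero i)).hom = 𝟙 (F.zpow i) := by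
  refine ZChain.Compat.ext (A := F.compChain (𝟭 C)) (B := F.compChain (𝟭 C))
    (f := fun i => (F.zpowAdd i 0 i (add_zero i)).hom)
    (g := fun i => 𝟙 (F.zpow i)) ?_ ?_ (F.zpowAdd_zero 0) i
  · intro n m h
    exact F.zpowAdd_step n m 0 n m (add_zero n) h h
  · intro n m h
    exact ((congrArg (fun α => α ≫ ((F.compChain (𝟭 C)).step n m h).hom)
      (F.postcomp.map_id (F.zpow n))).trans (Category.id_comp _)).trans (Category.comp_id _).symm

theorem npow_additive (F : C ⥤ C) [F.Additive] (n : ℕ) : (npow F n).Additive := by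
  induction n with
  | zero => exact inferInstanceAs (𝟭 C).Additive
  | succ n ih => exact inferInstanceAs (npow F n ⋙ F).Additive

theorem npow_linear (F : C ⥤ C) [F.Linear k] (n : ℕ) : (npow F n).Linear k := by
  induction n with
  | zero => exact inferInstanceAs ((𝟭 C).Linear k)
  | succ n ih => exact inferInstanceAs ((npow F n ⋙ F).Linear k)

/-- The powers of an autoequivalence form a `ℤ`-sequence. -/
noncomputable def powers (F : Autoequivalence k C) : ZSequence F where
  functor := F.zpow
  additive
    | .ofNat n => npow_additive F.functor n
    | .negSucc n => npow_additive F.functor.inv (n + 1)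
  linear
    | .ofNat n => npow_linear F.functor n
    | .negSucc n => npow_linear F.functor.inv (n + 1)
  one := ⟨Functor.leftUnitor F.functor⟩
  zero := Iso.refl _
  η := F.zpowAdd
  η_zero_left j X := by
    rw [F.zpowAdd_zero]
    exact Category.comp_id _
  η_zero_right i X := by
    rw [F.zpowAdd_right_zero]
    exact (Category.id_comp _).trans ((F.zpow i).map_id _)
  η_assoc i j l ij jl ijl h₁ h₂ h₃ h₄ X :=
    congrArg (fun α => α.app X) (F.zpowAdd_assoc i j l ij jl ijl h₁ h₂ h₃ h₄)

noncomputable instance (F : Autoequivalence k C) : Inhabited (ZSequence F) := ⟨F.powers⟩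

/-- `F` is `P`-generative: the objects `F^i P`, for `i ∈ ℤ`, generate the category. -/
def IsGenerative (F : Autoequivalence k C) (P : C) : Prop :=
  (ObjectProperty.ofObj fun i : ℤ => (F.zpow i).obj P).IsSeparating

end Autoequivalence

end Sequences

/-! ### Twisted endomorphism rings -/

section Twisted

variable {k : Type w} [CommRing k] {C : Type u} [Category.{v} C] [Preadditive C] [Linear k C]
  {F : Autoequivalence k C}

/-- The component `hom(F_n P, P)` of degree `n` of the twisted endomorphism ring. -/
def TwistedEndPiece (𝓕 : ZSequence F) (P : C) (n : ℤ) : Type v := (𝓕.functor n).obj P ⟶ P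

namespace TwistedEndPiece

variable (𝓕 : ZSequence F) (P : C)

instance (n : ℤ) : AddCommGroup (TwistedEndPiece 𝓕 P n) :=
  inferInstanceAs (AddCommGroup ((𝓕.functor n).obj P ⟶ P))

instance (n : ℤ) : Module k (TwistedEndPiece 𝓕 P n) :=
  inferInstanceAs (Module k ((𝓕.functor n).obj P ⟶ P))

/-- The product `a ⋆ b = a ∘ F_i(b) ∘ η i j` of `a : F_i P ⟶ P` and `b : F_j P ⟶ P`, a morphism
`F_{i+j} P ⟶ F_i F_j P ⟶ F_i P ⟶ P`. -/
def mulAt {i j : ℤ} (l : ℤ) (h : i + j = l) (a : (𝓕.functor i).obj P ⟶ P)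
    (b : (𝓕.functor j).obj P ⟶ P) : (𝓕.functor l).obj P ⟶ P :=
  (𝓕.η i j l h).hom.app P ≫ (𝓕.functor i).map b ≫ a

theorem one_mulAt {j : ℤ} (b : (𝓕.functor j).obj P ⟶ P) :
    mulAt 𝓕 P j (zero_add j) (𝓕.zero.hom.app P) b = b := by
  have h := 𝓕.zero.hom.naturality b
  dsimp only [Functor.id_map] at h
  unfold mulAt
  rw [h]
  exact (Category.assoc _ _ _).symm.trans
    ((congrArg (fun f => f ≫ b) (𝓕.η_zero_left j P)).trans (Category.id_comp b))

theorem mulAt_one {i : ℤ} (a : (𝓕.functor i).obj P ⟶ P) :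
    mulAt 𝓕 P i (add_zero i) a (𝓕.zero.hom.app P) = a :=
  (Category.assoc _ _ _).symm.trans
    ((congrArg (fun f => f ≫ a) (𝓕.η_zero_right i P)).trans (Category.id_comp a))

theorem mulAt_assoc {i j l : ℤ} (a : (𝓕.functor i).obj P ⟶ P) (b : (𝓕.functor j).obj P ⟶ P)
    (c : (𝓕.functor l).obj P ⟶ P) :
    mulAt 𝓕 P (i + j + l) rfl (mulAt 𝓕 P (i + j) rfl a b) c =
      mulAt 𝓕 P (i + j + l) (add_assoc i j l).symm a (mulAt 𝓕 P (j + l) rfl b c) := by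
  have h := 𝓕.η_assoc i j l _ _ _ rfl rfl (add_assoc i j l).symm rfl P
  have h' := (𝓕.η i j (i + j) rfl).hom.naturality c
  dsimp only [Functor.comp_map, Functor.comp_obj] at h h'
  simp only [mulAt, Functor.map_comp, Category.assoc]
  rw [reassoc_of% h, reassoc_of% h']

theorem add_mulAt {i j l : ℤ} (h : i + j = l) (a a' : (𝓕.functor i).obj P ⟶ P)
    (b : (𝓕.functor j).obj P ⟶ P) :
    mulAt 𝓕 P l h (a + a') b = mulAt 𝓕 P l h a b + mulAt 𝓕 P l h a' b := by
  simp only [mulAt, Preadditive.comp_add]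

theorem mulAt_add {i j l : ℤ} (h : i + j = l) (a : (𝓕.functor i).obj P ⟶ P)
    (b b' : (𝓕.functor j).obj P ⟶ P) :
    mulAt 𝓕 P l h a (b + b') = mulAt 𝓕 P l h a b + mulAt 𝓕 P l h a b' := by
  have := 𝓕.additive i
  simp only [mulAt, Functor.map_add, Preadditive.add_comp, Preadditive.comp_add]

theorem smul_mulAt {i j l : ℤ} (h : i + j = l) (r : k) (a : (𝓕.functor i).obj P ⟶ P)
    (b : (𝓕.functor j).obj P ⟶ P) :
    mulAt 𝓕 P l h (r • a) b = r • mulAt 𝓕 P l h a b := by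
  simp only [mulAt, Linear.comp_smul]

theorem mulAt_smul {i j l : ℤ} (h : i + j = l) (r : k) (a : (𝓕.functor i).obj P ⟶ P)
    (b : (𝓕.functor j).obj P ⟶ P) :
    mulAt 𝓕 P l h a (r • b) = r • mulAt 𝓕 P l h a b := by
  have := 𝓕.linear i
  simp only [mulAt, Functor.map_smul, Linear.smul_comp, Linear.comp_smul]

theorem mulAt_zero {i j l : ℤ} (h : i + j = l) (a : (𝓕.functor i).obj P ⟶ P) :
    mulAt 𝓕 P l h a (0 : (𝓕.functor j).obj P ⟶ P) = 0 := by
  have := 𝓕.additive i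
  simp only [mulAt, Functor.map_zero, Limits.zero_comp, Limits.comp_zero]

theorem zero_mulAt {i j l : ℤ} (h : i + j = l) (b : (𝓕.functor j).obj P ⟶ P) :
    mulAt 𝓕 P l h (0 : (𝓕.functor i).obj P ⟶ P) b = 0 := by
  simp only [mulAt, Limits.comp_zero]

instance : GradedMonoid.GMul (TwistedEndPiece 𝓕 P) where
  mul {i j} a b := mulAt 𝓕 P (i + j) rfl a b

instance : GradedMonoid.GOne (TwistedEndPiece 𝓕 P) where
  one := 𝓕.zero.hom.app P

theorem mk_mul_mk {i j : ℤ} (l : ℤ) (h : i + j = l) (a : TwistedEndPiece 𝓕 P i)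
    (b : TwistedEndPiece 𝓕 P j) :
    GradedMonoid.mk i a * GradedMonoid.mk j b =
      GradedMonoid.mk (A := TwistedEndPiece 𝓕 P) l (mulAt 𝓕 P l h a b) := by
  subst h
  rfl

instance : GradedMonoid.GMonoid (TwistedEndPiece 𝓕 P) where
  one_mul := by
    rintro ⟨j, b⟩
    exact (mk_mul_mk 𝓕 P j (zero_add j) _ b).trans (congrArg _ (one_mulAt 𝓕 P b))
  mul_one := by
    rintro ⟨i, a⟩
    exact (mk_mul_mk 𝓕 P i (add_zero i) a _).trans (congrArg _ (mulAt_one 𝓕 P a))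
  mul_assoc := by
    rintro ⟨i, a⟩ ⟨j, b⟩ ⟨l, c⟩
    refine (mk_mul_mk 𝓕 P _ rfl _ c).trans ((congrArg _ (mulAt_assoc 𝓕 P a b c)).trans ?_)
    exact (mk_mul_mk 𝓕 P _ (add_assoc i j l).symm a _).symm

instance : DirectSum.GRing (TwistedEndPiece 𝓕 P) where
  mul_zero := mulAt_zero 𝓕 P rfl
  zero_mul := zero_mulAt 𝓕 P rfl
  mul_add := mulAt_add 𝓕 P rfl
  add_mul := add_mulAt 𝓕 P rfl
  natCast n := n • GradedMonoid.GOne.one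
  natCast_zero := zero_smul _ _
  natCast_succ n := succ_nsmul _ n
  intCast n := n • GradedMonoid.GOne.one
  intCast_ofNat n := natCast_zsmul _ n
  intCast_negSucc_ofNat n := negSucc_zsmul _ n

instance : DirectSum.GAlgebra k (TwistedEndPiece 𝓕 P) where
  toFun := (LinearMap.toSpanSingleton k (TwistedEndPiece 𝓕 P 0)
    GradedMonoid.GOne.one).toAddMonoidHom
  map_one := one_smul k (𝓕.zero.hom.app P)
  map_mul r s := by
    refine Eq.trans ?_ (mk_mul_mk 𝓕 P 0 (add_zero 0) _ _).symm
    refine congrArg (GradedMonoid.mk (A := TwistedEndPiece 𝓕 P) 0) (Eq.symm ?_)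
    refine (smul_mulAt 𝓕 P _ r (𝓕.zero.hom.app P) _).trans ?_
    refine (congrArg (fun f => r • f) (one_mulAt 𝓕 P _)).trans ?_
    exact (mul_smul r s (𝓕.zero.hom.app P)).symm
  commutes r := by
    rintro ⟨i, a⟩
    refine (mk_mul_mk 𝓕 P i (zero_add i) _ a).trans
      (Eq.trans ?_ (mk_mul_mk 𝓕 P i (add_zero i) a _).symm)
    refine congrArg (GradedMonoid.mk (A := TwistedEndPiece 𝓕 P) i) ?_
    refine (smul_mulAt 𝓕 P _ r (𝓕.zero.hom.app P) a).trans
      (Eq.trans ?_ (mulAt_smul 𝓕 P _ r a (𝓕.zero.hom.app P)).symm)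
    exact congrArg (fun f => r • f) ((one_mulAt 𝓕 P a).trans (mulAt_one 𝓕 P a).symm)
  smul_def r := by
    rintro ⟨i, a⟩
    refine Eq.trans ?_ (mk_mul_mk 𝓕 P i (zero_add i) _ a).symm
    refine congrArg (GradedMonoid.mk (A := TwistedEndPiece 𝓕 P) i) (Eq.symm ?_)
    exact (smul_mulAt 𝓕 P _ r (𝓕.zero.hom.app P) a).trans
      (congrArg (fun f => r • f) (one_mulAt 𝓕 P a))

end TwistedEndPiece

/-- The twisted endomorphism ring `End^F(P) = ⨁ n, hom(F_n P, P)`. -/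
def TwistedEnd (𝓕 : ZSequence F) (P : C) : Type v := ⨁ n : ℤ, TwistedEndPiece 𝓕 P n

namespace TwistedEnd

variable (𝓕 : ZSequence F) (P : C)

instance : Ring (TwistedEnd 𝓕 P) := inferInstanceAs (Ring (⨁ n : ℤ, TwistedEndPiece 𝓕 P n))

instance : Algebra k (TwistedEnd 𝓕 P) :=
  inferInstanceAs (Algebra k (⨁ n : ℤ, TwistedEndPiece 𝓕 P n))

/-- The component of degree `n` of the twisted endomorphism ring, as a submodule. -/
def deg (n : ℤ) : Submodule k (TwistedEnd 𝓕 P) :=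
  LinearMap.range (DirectSum.lof k ℤ (TwistedEndPiece 𝓕 P) n)

instance : SetLike.GradedMonoid (deg 𝓕 P) where
  one_mem := ⟨GradedMonoid.GOne.one, rfl⟩
  mul_mem := by
    rintro i j _ _ ⟨a, rfl⟩ ⟨b, rfl⟩
    exact ⟨GradedMonoid.GMul.mul a b, (DirectSum.of_mul_of a b).symm⟩

/-- The decomposition into homogeneous components. -/
def decomposeMap : TwistedEnd 𝓕 P →ₗ[k] ⨁ n, deg 𝓕 P n :=
  DirectSum.toModule k ℤ (⨁ n, deg 𝓕 P n) fun n =>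
    (DirectSum.lof k ℤ (fun n => deg 𝓕 P n) n).comp
      (DirectSum.lof k ℤ (TwistedEndPiece 𝓕 P) n).rangeRestrict

theorem decomposeMap_lof (n : ℤ) (a : TwistedEndPiece 𝓕 P n) :
    decomposeMap 𝓕 P (DirectSum.lof k ℤ (TwistedEndPiece 𝓕 P) n a) =
      DirectSum.lof k ℤ (fun n => deg 𝓕 P n) n
        ⟨DirectSum.lof k ℤ (TwistedEndPiece 𝓕 P) n a, ⟨a, rfl⟩⟩ :=
  DirectSum.toModule_lof k n a

noncomputable instance : DirectSum.Decomposition (deg 𝓕 P) :=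
  DirectSum.Decomposition.ofLinearMap (deg 𝓕 P) (decomposeMap 𝓕 P)
    (by
      refine DirectSum.linearMap_ext k fun n => LinearMap.ext fun a => ?_
      exact (congrArg (DirectSum.coeLinearMap (deg 𝓕 P)) (decomposeMap_lof 𝓕 P n a)).trans
        (DirectSum.coeLinearMap_lof (deg 𝓕 P) n _))
    (by
      refine DirectSum.linearMap_ext k fun n => LinearMap.ext ?_
      rintro ⟨_, a, rfl⟩
      exact (congrArg (decomposeMap 𝓕 P) (DirectSum.coeLinearMap_lof (deg 𝓕 P) n _)).trans
        (decomposeMap_lof 𝓕 P n a))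

/-- The twisted endomorphism ring is a `ℤ`-graded `k`-algebra. -/
noncomputable instance : GradedAlgebra (deg 𝓕 P) where

end TwistedEnd

end Twisted

/-! ### Graded modules: components, subobjects, quotients, direct sums, shifts -/

/-! For a `ℤ`-sequence `𝓕`, adjoin to gr-R an isomorphism X ≅ F_n X of degree n for every X and n.
This gives the orbit category `Orb 𝓕`, in which the twisted endomorphism ring T of P is simply the
endomorphism ring of P, and X ↦ ⨁ hom(F_n P, X) becomes a functor H_P from gr-R to gr-T
(`homFunctor`).

The core is a graded Morita theorem, `homFunctor_isEquivalence`: if P is finitely generated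
projective and the F_n P generate, then H_P is an equivalence. Moreover H_P X is the shift of H_P
(F_1 X) (`homFunctorShift`), so H_P turns F into the inverse of the shift. The graded ring T
therefore remembers F up to conjugation.

If Q is a graded progenerator over T whose endomorphism ring is the twisted ring of P', choose X
with H_P X ≅ Q. Then X is again compact projective, the F_n X generate, and End Q is the twisted
ring of X. So H_X and H_{P'} land in graded modules over isomorphic graded rings; composing one with
a quasi-inverse of the other gives a G that conjugates F into F', because both correspond to the
inverse shift.

Conversely, an isomorphism G F ≅ F' G extends to isomorphisms G F_n ≅ F'_n G that respect `η`
(`conjIso_add`). Hence the twisted ring of P' is that of any X with G X ≅ P'. Since P and X generate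
each other up to twists, the identity of each is, in the orbit category, a finite sum of homogeneous
endomorphisms through the other (`IsSummand`); a dual basis argument then makes H_P X a progenerator
with the required endomorphism ring.

Finite generation and projectivity have to cross these equivalences, so they are replaced throughout
by the categorical property `IsCompactProjective`. -/

namespace GrMod

variable {k : Type w} [CommRing k] {R : Type u} [Ring R] [Algebra k R] {𝒜 : ℤ → Submodule k R}

/-- The linear map underlying a morphism of graded modules. -/
def lin {M N : GrMod 𝒜} (f : M ⟶ N) : M.carrier →ₗ[Rᵐᵒᵖ] N.carrier := f.1

/-- The morphism given by a degree-preserving linear map. -/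
def ofLin {M N : GrMod 𝒜} (f : M.carrier →ₗ[Rᵐᵒᵖ] N.carrier)
    (hf : ∀ i, ∀ m ∈ M.deg i, f m ∈ N.deg i) : M ⟶ N := ⟨f, hf⟩

theorem lin_mem {M N : GrMod 𝒜} (f : M ⟶ N) {i : ℤ} {m : M.carrier} (hm : m ∈ M.deg i) :
    lin f m ∈ N.deg i := f.2 i m hm

@[simp] theorem lin_comp {M N K : GrMod 𝒜} (f : M ⟶ N) (g : N ⟶ K) (m : M.carrier) :
    lin (f ≫ g) m = lin g (lin f m) := rfl

@[simp] theorem lin_add {M N : GrMod 𝒜} (f g : M ⟶ N) : lin (f + g) = lin f + lin g := rfl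

theorem lin_sum {M N : GrMod 𝒜} {ι : Type*} (s : Finset ι) (f : ι → (M ⟶ N)) :
    lin (∑ i ∈ s, f i) = ∑ i ∈ s, lin (f i) :=
  map_sum (AddMonoidHom.mk' (lin (M := M) (N := N)) lin_add) f s

theorem hom_ext {M N : GrMod 𝒜} {f g : M ⟶ N} (h : ∀ m, lin f m = lin g m) : f = g :=
  Subtype.ext (LinearMap.ext h)

/-- The projection to the homogeneous component of degree `i`. -/
noncomputable def proj (M : GrMod 𝒜) (i : ℤ) : M.carrier →ₗ[k] M.carrier :=
  (M.deg i).subtype ∘ₗ DirectSum.component k ℤ (fun i => M.deg i) i ∘ₗ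
    (LinearEquiv.ofBijective (DirectSum.coeLinearMap M.deg) M.isInternal).symm.toLinearMap

theorem proj_mem (M : GrMod 𝒜) (i : ℤ) (m : M.carrier) : M.proj i m ∈ M.deg i :=
  Subtype.property _

theorem symm_of_mem (M : GrMod 𝒜) {i : ℤ} {m : M.carrier} (hm : m ∈ M.deg i) :
    (LinearEquiv.ofBijective (DirectSum.coeLinearMap M.deg) M.isInternal).symm m =
      DirectSum.lof k ℤ (fun i => M.deg i) i ⟨m, hm⟩ := by
  rw [LinearEquiv.symm_apply_eq]
  exact (DirectSum.coeLinearMap_lof M.deg i ⟨m, hm⟩).symm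

theorem proj_of_mem (M : GrMod 𝒜) {i : ℤ} {m : M.carrier} (hm : m ∈ M.deg i) :
    M.proj i m = m := by
  simp [proj, symm_of_mem M hm, DirectSum.component.lof_self]

theorem proj_of_mem_ne (M : GrMod 𝒜) {i j : ℤ} {m : M.carrier} (hm : m ∈ M.deg j)
    (h : j ≠ i) : M.proj i m = 0 := by
  simp only [proj, LinearMap.comp_apply, LinearEquiv.coe_coe, symm_of_mem M hm]
  rw [DirectSum.component.of]
  simp [h]

theorem mem_iSup_deg (M : GrMod 𝒜) (m : M.carrier) : m ∈ ⨆ i, M.deg i := by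
  rw [M.isInternal.submodule_iSup_eq_top]
  trivial

/-- To prove a property of all elements, treat homogeneous elements and sums. -/
theorem induction (M : GrMod 𝒜) {p : M.carrier → Prop} (h0 : p 0)
    (hom : ∀ i, ∀ m ∈ M.deg i, p m) (add : ∀ x y, p x → p y → p (x + y)) (m : M.carrier) : p m :=
  Submodule.iSup_induction M.deg (motive := p) (M.mem_iSup_deg m) hom h0 add

/-- An element is the sum of its finitely many nonzero components. Additive subgroups are general
enough to cover both `⊥` and the image of a sum of components under an inclusion. -/
theorem mem_of_proj_mem (M : GrMod 𝒜) (N : AddSubgroup M.carrier) {m : M.carrier}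
    (h : ∀ i, M.proj i m ∈ N) : m ∈ N := by
  classical
  set e := LinearEquiv.ofBijective (DirectSum.coeLinearMap M.deg) M.isInternal with he
  have : m = ∑ i ∈ (e.symm m).support, M.proj i m := by
    conv_lhs => rw [← e.apply_symm_apply m, ← DirectSum.sum_support_of (e.symm m)]
    rw [map_sum]
    exact Finset.sum_congr rfl fun i _ => DirectSum.coeLinearMap_lof M.deg i _
  rw [this]
  exact N.sum_mem fun i _ => h i

theorem eq_zero_of_proj (M : GrMod 𝒜) {m : M.carrier} (h : ∀ i, M.proj i m = 0) : m = 0 :=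
  M.mem_of_proj_mem ⊥ h

theorem lin_proj {M N : GrMod 𝒜} (f : M ⟶ N) (i : ℤ) (m : M.carrier) :
    lin f (M.proj i m) = N.proj i (lin f m) := by
  induction m using M.induction with
  | h0 => simp
  | hom j m hm =>
    obtain rfl | h := eq_or_ne j i
    · rw [proj_of_mem M hm, proj_of_mem N (lin_mem f hm)]
    · rw [proj_of_mem_ne M hm h, proj_of_mem_ne N (lin_mem f hm) h, map_zero]
  | add x y hx hy => simp only [map_add, hx, hy]

theorem hom_ext_of_homogeneous {M N : GrMod 𝒜} {f g : M ⟶ N}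
    (h : ∀ i, ∀ m ∈ M.deg i, lin f m = lin g m) : f = g := by
  refine hom_ext fun m => ?_
  induction m using M.induction with
  | h0 => simp
  | hom j m hm => exact h j m hm
  | add x y hx hy => simp only [map_add, hx, hy]

/-- An element common to `d i` and the sum of the other pieces is both fixed and killed by `p i`.
All gradings constructed below are obtained from explicit projections in this way. -/
theorem isInternal_of_proj {V : Type*} [AddCommGroup V] [Module k V] (d : ℤ → Submodule k V)
    (p : ℤ → V →ₗ[k] V) (h1 : ∀ i, ∀ m ∈ d i, p i m = m)
    (h2 : ∀ i j, j ≠ i → ∀ m ∈ d j, p i m = 0) (h3 : ∀ m, m ∈ ⨆ i, d i) :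
    DirectSum.IsInternal d := by
  refine (DirectSum.isInternal_submodule_iff_iSupIndep_and_iSup_eq_top d).2
    ⟨?_, (Submodule.eq_top_iff').2 h3⟩
  intro i
  rw [Submodule.disjoint_def]
  intro m hm hm'
  have : (⨆ j, ⨆ (_ : j ≠ i), d j) ≤ LinearMap.ker (p i) :=
    iSup₂_le fun j hj m hm => h2 i j hj m hm
  rw [← h1 i m hm]
  exact this hm'

/-- A submodule that contains the homogeneous components of its elements. -/
def IsHomogeneous (M : GrMod 𝒜) (N : Submodule Rᵐᵒᵖ M.carrier) : Prop :=
  ∀ i, ∀ m ∈ N, M.proj i m ∈ N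

theorem isHomogeneous_ker {M N : GrMod 𝒜} (f : M ⟶ N) :
    M.IsHomogeneous (LinearMap.ker (lin f)) := by
  intro i m hm
  rw [LinearMap.mem_ker] at hm ⊢
  rw [lin_proj, hm, map_zero]

theorem isHomogeneous_iSup_range {ι : Type*} {Z : ι → GrMod 𝒜} {A : GrMod 𝒜}
    (x : ∀ j, Z j ⟶ A) : A.IsHomogeneous (⨆ j, LinearMap.range (lin (x j))) := by
  intro i m hm
  induction hm using Submodule.iSup_induction' with
  | mem j m hm =>
    obtain ⟨z, rfl⟩ := hm
    rw [← lin_proj]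
    exact Submodule.mem_iSup_of_mem j ⟨_, rfl⟩
  | zero => rw [map_zero]; exact Submodule.zero_mem _
  | add x y _ _ hx hy => rw [map_add]; exact Submodule.add_mem _ hx hy

/-- The graded submodule given by a homogeneous submodule. -/
def sub (M : GrMod 𝒜) (N : Submodule Rᵐᵒᵖ M.carrier) (hN : M.IsHomogeneous N) : GrMod 𝒜 where
  carrier := N
  deg i := (M.deg i).comap (N.subtype.restrictScalars k)
  isInternal := by
    refine isInternal_of_proj _ (fun i =>
      ((M.proj i).comp (N.subtype.restrictScalars k)).codRestrict (N.restrictScalars k)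
        fun m => hN i m.1 m.2) ?_ ?_ ?_
    · intro i m hm
      exact Subtype.ext (M.proj_of_mem hm)
    · intro i j h m hm
      exact Subtype.ext (M.proj_of_mem_ne hm h)
    · intro m
      set d : ℤ → Submodule k N := fun i => (M.deg i).comap (N.subtype.restrictScalars k)
      -- The components of `m` in `M` lie in `N` by homogeneity, so `m` is in the image of the sum
      -- of the pieces of `N`; injectivity of the inclusion then brings it back to `N`.
      have key : m.1 ∈ (⨆ i, d i).toAddSubgroup.map N.toAddSubgroup.subtype := by
        refine M.mem_of_proj_mem _ fun i => ⟨⟨M.proj i m.1, hN i m.1 m.2⟩, ?_, rfl⟩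
        exact Submodule.mem_iSup_of_mem (p := d) i (M.proj_mem i m.1)
      obtain ⟨m', hm', h⟩ := key
      rwa [← Subtype.ext h]
  smul_mem i j m r hm hr := M.smul_mem i j m.1 r hm hr

/-- The inclusion of a graded submodule. -/
def subι (M : GrMod 𝒜) (N : Submodule Rᵐᵒᵖ M.carrier) (hN : M.IsHomogeneous N) :
    M.sub N hN ⟶ M :=
  ofLin N.subtype fun _ _ hm => hm

/-- The factorization of a morphism through a graded submodule. -/
def subLift {M : GrMod 𝒜} (N : Submodule Rᵐᵒᵖ M.carrier) (hN : M.IsHomogeneous N) {X : GrMod 𝒜}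
    (f : X ⟶ M) (hf : ∀ x, lin f x ∈ N) : X ⟶ M.sub N hN :=
  ofLin ((lin f).codRestrict N hf) fun _ _ hm => lin_mem f hm

theorem subLift_ι {M : GrMod 𝒜} (N : Submodule Rᵐᵒᵖ M.carrier) (hN : M.IsHomogeneous N)
    {X : GrMod 𝒜} (f : X ⟶ M) (hf : ∀ x, lin f x ∈ N) :
    subLift N hN f hf ≫ M.subι N hN = f := rfl

/-- The quotient by a homogeneous submodule. -/
def quot (M : GrMod 𝒜) (N : Submodule Rᵐᵒᵖ M.carrier) (hN : M.IsHomogeneous N) : GrMod 𝒜 where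
  carrier := M.carrier ⧸ N
  deg i := (M.deg i).map (N.mkQ.restrictScalars k)
  isInternal := by
    refine isInternal_of_proj _ (fun i =>
      (N.restrictScalars k).mapQ (N.restrictScalars k) (M.proj i) fun m hm => hN i m hm) ?_ ?_ ?_
    · rintro i _ ⟨m, hm, rfl⟩
      exact congrArg N.mkQ (M.proj_of_mem hm)
    · rintro i j h _ ⟨m, hm, rfl⟩
      exact (congrArg N.mkQ (M.proj_of_mem_ne hm h)).trans (map_zero _)
    · intro q
      obtain ⟨m, rfl⟩ := N.mkQ_surjective q
      rw [← Submodule.map_iSup]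
      exact ⟨m, M.mem_iSup_deg m, rfl⟩
  smul_mem := by
    rintro i j _ r ⟨m, hm, rfl⟩ hr
    exact ⟨_, M.smul_mem i j m r hm hr, rfl⟩

/-- The projection to a quotient. -/
def quotπ (M : GrMod 𝒜) (N : Submodule Rᵐᵒᵖ M.carrier) (hN : M.IsHomogeneous N) :
    M ⟶ M.quot N hN :=
  ofLin N.mkQ fun _ m hm => ⟨m, hm, rfl⟩

theorem quotπ_surjective (M : GrMod 𝒜) (N : Submodule Rᵐᵒᵖ M.carrier) (hN : M.IsHomogeneous N) :
    Function.Surjective (lin (M.quotπ N hN)) := N.mkQ_surjective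

theorem quotπ_eq_zero_iff (M : GrMod 𝒜) (N : Submodule Rᵐᵒᵖ M.carrier) (hN : M.IsHomogeneous N)
    (m : M.carrier) : lin (M.quotπ N hN) m = 0 ↔ m ∈ N := Submodule.Quotient.mk_eq_zero N

section DirectSum

variable {ι : Type u} (Z : ι → GrMod 𝒜)

open Classical in
/-- The direct sum of a family of graded modules. -/
noncomputable def dsum : GrMod 𝒜 where
  carrier := ⨁ j, (Z j).carrier
  deg i :=
    { carrier := {x | ∀ j, x j ∈ (Z j).deg i}
      zero_mem' := fun j => ((Z j).deg i).zero_mem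
      add_mem' := fun hx hy j => ((Z j).deg i).add_mem (hx j) (hy j)
      smul_mem' := fun c _ hx j => ((Z j).deg i).smul_mem c (hx j) }
  isInternal := by
    refine isInternal_of_proj _ (fun i => DirectSum.lmap fun j => (Z j).proj i) ?_ ?_ ?_
    · intro i m hm
      refine DFinsupp.ext fun j => ?_
      exact (DirectSum.lmap_apply (fun j => (Z j).proj i) m j).trans ((Z j).proj_of_mem (hm j))
    · intro i j' h m hm
      refine DFinsupp.ext fun j => ?_
      exact (DirectSum.lmap_apply (fun j => (Z j).proj i) m j).trans
        ((Z j).proj_of_mem_ne (hm j) h)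
    · intro m
      induction m using DirectSum.induction_on with
      | zero => exact Submodule.zero_mem _
      | add x y hx hy => exact Submodule.add_mem _ hx hy
      | of j z =>
        induction z using (Z j).induction with
        | h0 => rw [map_zero]; exact Submodule.zero_mem _
        | add x y hx hy => rw [map_add]; exact Submodule.add_mem _ hx hy
        | hom i z hz =>
          refine Submodule.mem_iSup_of_mem i fun j' => ?_
          obtain rfl | h := eq_or_ne j j'
          · rwa [DirectSum.of_eq_same]
          · rw [DirectSum.of_eq_of_ne _ _ _ h.symm]
            exact Submodule.zero_mem _
  smul_mem i l m r hm hr j := (Z j).smul_mem i l (m j) r (hm j) hr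

open Classical in
/-- The inclusion of a summand. -/
noncomputable def dsumι (j : ι) : Z j ⟶ dsum Z :=
  ofLin (DirectSum.lof Rᵐᵒᵖ ι (fun j => (Z j).carrier) j) fun i m hm j' => by
    obtain rfl | h := eq_or_ne j j'
    · change DirectSum.of (fun j => (Z j).carrier) j m j ∈ _
      rwa [DirectSum.of_eq_same]
    · change DirectSum.of (fun j => (Z j).carrier) j m j' ∈ _
      rw [DirectSum.of_eq_of_ne _ _ _ h.symm]
      exact Submodule.zero_mem _

/-- The projection to a summand. -/
noncomputable def dsumπ (j : ι) : dsum Z ⟶ Z j :=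
  ofLin (DirectSum.component Rᵐᵒᵖ ι (fun j => (Z j).carrier) j) fun _ _ hm => hm j

open Classical in
/-- The morphism from a direct sum with given restrictions. -/
noncomputable def dsumDesc {A : GrMod 𝒜} (x : ∀ j, Z j ⟶ A) : dsum Z ⟶ A :=
  ofLin (M := dsum Z) (DirectSum.toModule Rᵐᵒᵖ ι A.carrier fun j => lin (x j)) <| by
    intro i (m : ⨁ j, (Z j).carrier) (hm : ∀ j, m j ∈ (Z j).deg i)
    change DirectSum.toModule Rᵐᵒᵖ ι A.carrier (fun j => lin (x j)) m ∈ A.deg i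
    have : m = m.sum fun j z => DirectSum.of (fun j => (Z j).carrier) j z :=
      (DFinsupp.sum_single (f := m)).symm
    rw [this]
    unfold DFinsupp.sum
    rw [map_sum]
    refine Submodule.sum_mem _ fun j _ => ?_
    have h : DirectSum.toModule Rᵐᵒᵖ ι A.carrier (fun j => lin (x j))
        (DirectSum.of (fun j => (Z j).carrier) j (m j)) = lin (x j) (m j) :=
      DirectSum.toModule_lof Rᵐᵒᵖ (φ := fun j => (lin (x j) : (Z j).carrier →ₗ[Rᵐᵒᵖ] A.carrier)) j (m j)
    rw [h]
    exact lin_mem _ (hm j)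

variable {Z}

theorem dsumι_desc {A : GrMod 𝒜} (x : ∀ j, Z j ⟶ A) (j : ι) : dsumι Z j ≫ dsumDesc Z x = x j := by
  classical
  exact hom_ext fun m => DirectSum.toModule_lof Rᵐᵒᵖ (φ := fun j => lin (x j)) j m

theorem dsumι_π (j : ι) : dsumι Z j ≫ dsumπ Z j = 𝟙 _ := by
  classical
  exact hom_ext fun m =>
    DirectSum.component.lof_self Rᵐᵒᵖ (M := fun j => (Z j).carrier) j m

theorem dsumι_π_ne {j j' : ι} (h : j ≠ j') : dsumι Z j ≫ dsumπ Z j' = 0 := by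
  classical
  refine hom_ext fun m => ?_
  exact DirectSum.of_eq_of_ne (β := fun j => (Z j).carrier) j j' m h.symm

theorem dsum_induction {p : (dsum Z).carrier → Prop} (h0 : p 0)
    (hι : ∀ j z, p (lin (dsumι Z j) z)) (add : ∀ x y, p x → p y → p (x + y))
    (m : (dsum Z).carrier) : p m := by
  classical
  exact DirectSum.induction_on m h0 hι add

theorem dsum_ext {m m' : (dsum Z).carrier} (h : ∀ j, lin (dsumπ Z j) m = lin (dsumπ Z j) m') :
    m = m' := DFinsupp.ext h

theorem dsum_hom_ext {A : GrMod 𝒜} {f g : dsum Z ⟶ A}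
    (h : ∀ j, dsumι Z j ≫ f = dsumι Z j ≫ g) : f = g := by
  refine hom_ext fun m => ?_
  induction m using dsum_induction with
  | h0 => simp
  | hι j z => exact congrArg (fun f => lin f z) (h j)
  | add x y hx hy => simp only [map_add, hx, hy]

/-- An element of a direct sum is the sum of finitely many components. -/
theorem dsum_exists_finset (m : (dsum Z).carrier) :
    ∃ s : Finset ι, ∀ t, s ⊆ t → ∑ j ∈ t, lin (dsumι Z j) (lin (dsumπ Z j) m) = m := by
  classical
  refine ⟨DFinsupp.support (m : Π₀ j, (Z j).carrier), fun t ht => ?_⟩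
  have : m = DFinsupp.sum (m : Π₀ j, (Z j).carrier)
      fun j z => DirectSum.of (fun j => (Z j).carrier) j z :=
    (DFinsupp.sum_single (f := m)).symm
  conv_rhs => rw [this]
  refine (Finset.sum_subset ht fun j _ hj => ?_).symm
  have h : lin (dsumπ Z j) m = 0 := DFinsupp.notMem_support_iff.1 hj
  rw [h, map_zero]

end DirectSum

/-- The morphism given by a bijective degree-preserving map is an isomorphism. -/
noncomputable def isoOfBijective {M N : GrMod 𝒜} (f : M ⟶ N) (hf : Function.Bijective (lin f)) :
    M ≅ N where
  hom := f
  inv := ofLin (LinearEquiv.ofBijective (lin f) hf).symm.toLinearMap fun i n hn => by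
    obtain ⟨m, rfl⟩ := hf.2 n
    have : (LinearEquiv.ofBijective (lin f) hf).symm (lin f m) = m :=
      (LinearEquiv.ofBijective (lin f) hf).symm_apply_apply m
    change (LinearEquiv.ofBijective (lin f) hf).symm (lin f m) ∈ M.deg i
    -- Since `f m` has degree i, `m` and its component of degree i have the same image, so
    -- injectivity makes `m` homogeneous.
    have h : lin f m = lin f (M.proj i m) := by rw [lin_proj, proj_of_mem N hn]
    rw [this, hf.1 h]
    exact M.proj_mem i m
  hom_inv_id := hom_ext fun m => (LinearEquiv.ofBijective (lin f) hf).symm_apply_apply m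
  inv_hom_id := hom_ext fun m => (LinearEquiv.ofBijective (lin f) hf).apply_symm_apply m

theorem exists_lift_of_surjective {A M N : GrMod 𝒜} (f : A ⟶ M) (g : A ⟶ N)
    (hf : Function.Surjective (lin f)) (h : ∀ a, lin f a = 0 → lin g a = 0) :
    ∃ t : M ⟶ N, f ≫ t = g := by
  let e := (lin f).quotKerEquivOfSurjective hf
  let t : M.carrier →ₗ[Rᵐᵒᵖ] N.carrier :=
    ((LinearMap.ker (lin f)).liftQ (lin g) fun a ha => h a ha).comp e.symm.toLinearMap
  have ht : ∀ a, t (lin f a) = lin g a := by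
    intro a
    have : e.symm (lin f a) = Submodule.Quotient.mk a := by
      rw [LinearEquiv.symm_apply_eq]
      rfl
    exact congrArg ((LinearMap.ker (lin f)).liftQ (lin g) fun a ha => h a ha) this
  refine ⟨ofLin t fun i m hm => ?_, hom_ext ht⟩
  obtain ⟨a, rfl⟩ := hf m
  -- The chosen lift `a` need not be homogeneous, but its component of degree i lifts the same
  -- element.
  rw [← M.proj_of_mem hm, ← lin_proj, ht]
  exact lin_mem g (A.proj_mem i a)

theorem epi_of_surjective {M N : GrMod 𝒜} (f : M ⟶ N) (hf : Function.Surjective (lin f)) :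
    Epi f where
  left_cancellation g h e := hom_ext fun n => by
    obtain ⟨m, rfl⟩ := hf n
    exact congrArg (fun f => lin f m) e

/-- Each surjection factors through the other, and the two factorizations are mutually inverse
because surjections are epimorphisms. Essential surjectivity of `homFunctor` is reduced to this
comparison of kernels. -/
theorem nonempty_iso_of_ker_eq {A M N : GrMod 𝒜} (f : A ⟶ M) (g : A ⟶ N)
    (hf : Function.Surjective (lin f)) (hg : Function.Surjective (lin g))
    (h : ∀ a, lin f a = 0 ↔ lin g a = 0) : Nonempty (M ≅ N) := by
  obtain ⟨t, ht⟩ := exists_lift_of_surjective f g hf fun a => (h a).1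
  obtain ⟨t', ht'⟩ := exists_lift_of_surjective g f hg fun a => (h a).2
  have := epi_of_surjective f hf
  have := epi_of_surjective g hg
  exact ⟨⟨t, t', (cancel_epi f).1 (by rw [reassoc_of% ht, ht', Category.comp_id]),
    (cancel_epi g).1 (by rw [reassoc_of% ht', ht, Category.comp_id])⟩⟩

/-- The shift of a graded module, with component `M_{i + 1}` in degree `i`. -/
def shiftObj (M : GrMod 𝒜) : GrMod 𝒜 where
  carrier := M.carrier
  deg i := M.deg (i + 1)
  isInternal := by
    refine isInternal_of_proj _ (fun i => M.proj (i + 1)) ?_ ?_ ?_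
    · exact fun i m hm => M.proj_of_mem hm
    · exact fun i j h m hm => M.proj_of_mem_ne hm (by simpa using h)
    · intro m
      have : (⨆ i : ℤ, M.deg (i + 1)) = ⨆ i, M.deg i :=
        (Equiv.addRight (1 : ℤ)).iSup_comp (g := M.deg)
      rw [this]
      exact M.mem_iSup_deg m
  smul_mem i j m r hm hr := by
    have := M.smul_mem (i + 1) j m r hm hr
    rwa [add_right_comm] at this

/-- The shift functor. -/
def shift (𝒜 : ℤ → Submodule k R) : GrMod 𝒜 ⥤ GrMod 𝒜 where
  obj := shiftObj
  map {M N} f := ⟨f.1, fun i m hm => f.2 (i + 1) m hm⟩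

instance : (shift 𝒜).Faithful where
  map_injective {M N} f g h := by
    refine hom_ext fun m => ?_
    exact congrArg (fun f : shiftObj M ⟶ shiftObj N => f.1 m) h

instance : (shift 𝒜).Full where
  map_surjective {M N} f :=
    ⟨⟨f.1, fun i m hm => by
      -- Degree i of `M` is degree i - 1 of its shift.
      have h := f.2 (i - 1) m (by rwa [← sub_add_cancel i 1] at hm)
      change f.1 m ∈ N.deg (i - 1 + 1) at h
      rwa [sub_add_cancel] at h⟩, Subtype.ext rfl⟩

end GrMod

/-! ### Compact projective objects -/

section Compact

variable {C : Type u} [Category.{v} C]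

/-- A family of morphisms with a common target is jointly epimorphic. -/
def JointlyEpi {ι : Type*} {Z : ι → C} {A : C} (x : ∀ j, Z j ⟶ A) : Prop :=
  ∀ ⦃B : C⦄ (f g : A ⟶ B), (∀ j, x j ≫ f = x j ≫ g) → f = g

theorem isSeparating_iff_jointlyEpi {ι : Type*} (Z : ι → C) :
    (ObjectProperty.ofObj Z).IsSeparating ↔
      ∀ A : C, JointlyEpi (fun j : Σ i, (Z i ⟶ A) => j.2) := by
  constructor
  · intro h A B f g hfg
    refine h f g ?_
    rintro _ ⟨i⟩ a
    exact hfg ⟨i, a⟩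
  · intro h A B f g hfg
    exact h A f g fun j => hfg (Z j.1) ⟨j.1⟩ j.2

theorem JointlyEpi.of_equivalence {D : Type*} [Category* D] (E : D ⥤ C) [E.IsEquivalence]
    {ι : Type*} {Z : ι → D} {A : D} {x : ∀ j, Z j ⟶ A} (hx : JointlyEpi x) :
    JointlyEpi fun j => E.map (x j) := by
  intro B f g h
  let e := E.objObjPreimageIso B
  have : E.preimage (f ≫ e.inv) = E.preimage (g ≫ e.inv) := by
    refine hx _ _ fun j => E.map_injective ?_
    simp only [Functor.map_comp, Functor.map_preimage, reassoc_of% h j]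
  have h2 := congrArg E.map this
  simp only [Functor.map_preimage] at h2
  exact (cancel_mono _).1 h2

variable [Preadditive C]

/-- The additive group generated by the morphisms that factor through a member of a family. -/
def factoring {ι : Type*} {Z : ι → C} {A : C} (x : ∀ j, Z j ⟶ A) (Y : C) : AddSubgroup (Y ⟶ A) :=
  AddSubgroup.closure {a | ∃ j, ∃ b : Y ⟶ Z j, a = b ≫ x j}

theorem comp_mem_factoring {ι : Type*} {Z : ι → C} {A : C} (x : ∀ j, Z j ⟶ A) {Y : C} (j : ι)
    (b : Y ⟶ Z j) : b ≫ x j ∈ factoring x Y :=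
  AddSubgroup.subset_closure ⟨j, b, rfl⟩

/-- An object is compact projective if each morphism to the target of a jointly epimorphic family
is a finite sum of morphisms that factor through the members of the family. -/
def IsCompactProjective (Y : C) : Prop :=
  ∀ ⦃ι : Type v⦄ (Z : ι → C) (A : C) (x : ∀ j, Z j ⟶ A), JointlyEpi x → ∀ a : Y ⟶ A,
    a ∈ factoring x Y

theorem IsCompactProjective.of_iso {Y Y' : C} (hY : IsCompactProjective Y) (e : Y ≅ Y') :
    IsCompactProjective Y' := by
  intro ι Z A x hx a
  have key : ∀ b ∈ factoring x Y, e.inv ≫ b ∈ factoring x Y' := by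
    intro b hb
    induction hb using AddSubgroup.closure_induction with
    | mem b hb =>
      obtain ⟨j, b, rfl⟩ := hb
      rw [← Category.assoc]
      exact comp_mem_factoring x j _
    | zero => rw [Limits.comp_zero]; exact zero_mem _
    | add b b' _ _ h h' => rw [Preadditive.comp_add]; exact add_mem h h'
    | neg b _ h => rw [Preadditive.comp_neg]; exact neg_mem h
  simpa using key _ (hY Z A x hx (e.hom ≫ a))

/-- The property involves only jointly epimorphic families, composition and sums: the family is
pushed forward along `E`, and the resulting finite sum is pulled back by full faithfulness. This
lets the property pass between gr-R and graded modules over a twisted endomorphism ring. -/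
theorem IsCompactProjective.of_map {D : Type*} [Category.{v} D] [Preadditive D] (E : C ⥤ D)
    [E.IsEquivalence] [E.Additive] {Y : C} (hY : IsCompactProjective (E.obj Y)) :
    IsCompactProjective Y := by
  intro ι Z A x hx a
  have key : ∀ b ∈ factoring (fun j => E.map (x j)) (E.obj Y), E.preimage b ∈ factoring x Y := by
    intro b hb
    induction hb using AddSubgroup.closure_induction with
    | mem b hb =>
      obtain ⟨j, b, rfl⟩ := hb
      have : E.preimage (b ≫ E.map (x j)) = E.preimage b ≫ x j := E.map_injective (by simp)
      rw [this]
      exact comp_mem_factoring x j _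
    | zero =>
      have : E.preimage (0 : E.obj Y ⟶ E.obj A) = 0 := E.map_injective (by simp)
      rw [this]
      exact zero_mem _
    | add b b' _ _ h h' =>
      have : E.preimage (b + b') = E.preimage b + E.preimage b' := E.map_injective (by simp)
      rw [this]
      exact add_mem h h'
    | neg b _ h =>
      have : E.preimage (-b) = -E.preimage b := E.map_injective (by simp)
      rw [this]
      exact neg_mem h
  simpa using key _ (hY _ _ _ (hx.of_equivalence E) (E.map a))

theorem IsCompactProjective.map {D : Type*} [Category.{v} D] [Preadditive D] (E : C ⥤ D)
    [E.IsEquivalence] [E.Additive] {Y : C} (hY : IsCompactProjective Y) :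
    IsCompactProjective (E.obj Y) :=
  have : E.inv.Additive :=
    have : E.asEquivalence.functor.Additive := inferInstanceAs E.Additive
    E.asEquivalence.inverse_additive
  IsCompactProjective.of_map E.inv (hY.of_iso (E.asEquivalence.unitIso.app Y))

end Compact

/-! ### Finitely generated projective graded modules are compact projective -/

namespace GrMod

variable {k : Type w} [CommRing k] {R : Type u} [Ring R] [Algebra k R] {𝒜 : ℤ → Submodule k R}

/-- The projection to the quotient by the sum of the ranges agrees with zero on every member of the
family, hence is zero. -/
theorem iSup_range_eq_top_of_jointlyEpi {ι : Type*} {Z : ι → GrMod 𝒜} {A : GrMod 𝒜}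
    {x : ∀ j, Z j ⟶ A} (hx : JointlyEpi x) : ⨆ j, LinearMap.range (lin (x j)) = ⊤ := by
  rw [Submodule.eq_top_iff']
  intro a
  have h := hx (A.quotπ _ (isHomogeneous_iSup_range x)) 0 fun j => hom_ext fun z => by
    refine (A.quotπ_eq_zero_iff _ (isHomogeneous_iSup_range x) _).2 ?_
    exact Submodule.mem_iSup_of_mem j ⟨z, rfl⟩
  exact (A.quotπ_eq_zero_iff _ (isHomogeneous_iSup_range x) a).1 (congrArg (fun f => lin f a) h)

theorem surjective_of_epi {M N : GrMod 𝒜} (f : M ⟶ N) [Epi f] : Function.Surjective (lin f) := by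
  have := iSup_range_eq_top_of_jointlyEpi (Z := fun _ : Unit => M) (x := fun _ => f)
    fun _ g h e => (cancel_epi f).1 (e ())
  rw [ciSup_const] at this
  exact LinearMap.range_eq_top.1 this

theorem dsumDesc_surjective {ι : Type u} {Z : ι → GrMod 𝒜} {A : GrMod 𝒜}
    {x : ∀ j, Z j ⟶ A} (hx : JointlyEpi x) : Function.Surjective (lin (dsumDesc Z x)) := by
  rw [← LinearMap.range_eq_top, eq_top_iff, ← iSup_range_eq_top_of_jointlyEpi hx]
  refine iSup_le fun j => ?_
  rintro _ ⟨z, rfl⟩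
  exact ⟨lin (dsumι Z j) z, congrArg (fun f => lin f z) (dsumι_desc x j)⟩

/-- The family gives a surjection from the direct sum, through which `a` lifts by projectivity. The
images of finitely many generators involve only finitely many summands, so the lift is a finite sum
of its components. -/
theorem isCompactProjective_of_finite {P : GrMod 𝒜} (hfin : Module.Finite Rᵐᵒᵖ P.carrier)
    (hproj : Projective P) : IsCompactProjective P := by
  classical
  intro ι Z A x hx a
  have := epi_of_surjective _ (dsumDesc_surjective hx)
  let a' := Projective.factorThru a (dsumDesc Z x)
  have ha' : a' ≫ dsumDesc Z x = a := Projective.factorThru_comp _ _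
  obtain ⟨G, hG⟩ := hfin.fg_top
  choose s hs using fun m => dsum_exists_finset (Z := Z) (lin a' m)
  let t := G.biUnion s
  have key : a' = ∑ j ∈ t, a' ≫ dsumπ Z j ≫ dsumι Z j := by
    refine hom_ext fun m => ?_
    have hm : m ∈ Submodule.span Rᵐᵒᵖ (G : Set P.carrier) := hG ▸ Submodule.mem_top
    induction hm using Submodule.span_induction with
    | mem m hm =>
      rw [lin_sum, LinearMap.sum_apply]
      exact (hs m t (Finset.subset_biUnion_of_mem s hm)).symm
    | zero => simp only [map_zero]
    | add a b _ _ ha hb => rw [map_add, ha, hb, map_add]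
    | smul r a _ ha => rw [map_smul, ha, map_smul]
  rw [← ha', key, Preadditive.sum_comp]
  refine sum_mem fun j _ => ?_
  rw [Category.assoc, Category.assoc, dsumι_desc, ← Category.assoc]
  exact comp_mem_factoring x j _

theorem proj_smul {M : GrMod 𝒜} (i j : ℤ) {r : R} (hr : r ∈ 𝒜 j) (m : M.carrier) :
    M.proj (i + j) (MulOpposite.op r • m) = MulOpposite.op r • M.proj i m := by
  induction m using M.induction with
  | h0 => simp
  | add x y hx hy => simp only [smul_add, map_add, hx, hy]
  | hom l m hm =>
    have := M.smul_mem l j m r hm hr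
    obtain rfl | h := eq_or_ne l i
    · rw [proj_of_mem M this, proj_of_mem M hm]
    · rw [proj_of_mem_ne M hm h, smul_zero, proj_of_mem_ne M this (by simpa using h)]

/-! ### Degree-zero components of ungraded maps -/

section DegreeZero

variable [GradedAlgebra 𝒜]

/-- An additive map that commutes with homogeneous scalars on homogeneous elements is linear. -/
theorem smul_induction {M N : GrMod 𝒜} (φ : M.carrier →+ N.carrier)
    (h : ∀ j, ∀ r ∈ 𝒜 j, ∀ i, ∀ m ∈ M.deg i,
      φ (MulOpposite.op r • m) = MulOpposite.op r • φ m) (r : Rᵐᵒᵖ) (m : M.carrier) :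
    φ (r • m) = r • φ m := by
  induction m using M.induction with
  | h0 => simp
  | add x y hx hy => simp only [smul_add, map_add, hx, hy]
  | hom i m hm =>
    obtain ⟨r, rfl⟩ := MulOpposite.op_surjective r
    induction r using DirectSum.Decomposition.inductionOn 𝒜 with
    | zero => simp
    | homogeneous r => exact h _ _ r.2 i m hm
    | add r r' hr hr' => simp only [MulOpposite.op_add, add_smul, map_add, hr, hr']

/-- The degree-zero component of a linear map between graded modules. -/
theorem exists_degreeZero {M N : GrMod 𝒜} (φ : M.carrier →ₗ[Rᵐᵒᵖ] N.carrier) :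
    ∃ f : M ⟶ N, ∀ i, ∀ m ∈ M.deg i, lin f m = N.proj i (φ m) := by
  let e := LinearEquiv.ofBijective (DirectSum.coeLinearMap M.deg) M.isInternal
  let ψ : M.carrier →ₗ[k] N.carrier :=
    (DirectSum.toModule k ℤ N.carrier fun i =>
      (N.proj i).comp ((φ.restrictScalars k).comp (M.deg i).subtype)).comp e.symm.toLinearMap
  have hψ : ∀ i, ∀ m ∈ M.deg i, ψ m = N.proj i (φ m) := by
    intro i m hm
    have : e.symm m = _ := symm_of_mem M hm
    simp only [ψ, LinearMap.comp_apply, LinearEquiv.coe_coe, this, DirectSum.toModule_lof]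
    rfl
  refine ⟨ofLin
    { toFun := ψ
      map_add' := ψ.map_add
      map_smul' := smul_induction ψ.toAddMonoidHom fun j r hr i m hm => ?_ } fun i m hm => ?_, hψ⟩
  · have h1 : ψ (MulOpposite.op r • m) = _ := hψ _ _ (M.smul_mem i j m r hm hr)
    refine h1.trans ?_
    rw [map_smul, proj_smul i j hr]
    exact congrArg _ (hψ i m hm).symm
  · have h1 : ψ m = _ := hψ i m hm
    exact h1 ▸ N.proj_mem i _

/-- An ungraded lift exists, and its degree-zero component is still a lift because `e` and `f`
preserve degrees. This is needed because the progenerator in graded Morita equivalence is projective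
among ungraded modules. -/
theorem projective_of_projective {Q : GrMod 𝒜} (hQ : Module.Projective Rᵐᵒᵖ Q.carrier) :
    Projective Q where
  factors {E X} f e _ := by
    obtain ⟨φ, hφ⟩ := Module.projective_lifting_property (lin e) (lin f) (surjective_of_epi e)
    obtain ⟨g, hg⟩ := exists_degreeZero φ
    refine ⟨g, hom_ext_of_homogeneous fun i m hm => ?_⟩
    rw [lin_comp, hg i m hm, lin_proj]
    have : lin e (φ m) = lin f m := LinearMap.congr_fun hφ m
    rw [this, proj_of_mem X (lin_mem f hm)]

end DegreeZero

end GrMod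

/-! ### The orbit category of a `ℤ`-sequence -/

section Orbit

variable {k : Type w} [CommRing k] {C : Type u} [Category.{v} C] [Preadditive C] [Linear k C]
  {F : Autoequivalence k C}

instance (𝓕 : ZSequence F) (i : ℤ) : (𝓕.functor i).Additive := 𝓕.additive i

instance (𝓕 : ZSequence F) (i : ℤ) : (𝓕.functor i).Linear k := 𝓕.linear i

/-- The quasi-inverse is F_{-i}. No triangle identity has to be checked, since `Equivalence.mk`
adjusts the unit. -/
instance (𝓕 : ZSequence F) (i : ℤ) : (𝓕.functor i).IsEquivalence :=
  (CategoryTheory.Equivalence.mk (𝓕.functor i) (𝓕.functor (-i))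
    (𝓕.zero.symm ≪≫ 𝓕.η (-i) i 0 (neg_add_cancel i))
    ((𝓕.η i (-i) 0 (add_neg_cancel i)).symm ≪≫ 𝓕.zero)).isEquivalence_functor

/-- The orbit category of a `ℤ`-sequence: it has the same objects, and the morphisms `X ⟶ Y` of
degree `n` are the morphisms `F_n X ⟶ Y`. -/
structure Orb (𝓕 : ZSequence F) where
  of ::
  obj : C

namespace Orb

variable (𝓕 : ZSequence F)

/-- The product of `a : F_i Y ⟶ Z` and `b : F_j X ⟶ Y`. -/
def star {X Y Z : C} {i j : ℤ} (l : ℤ) (h : i + j = l) (a : (𝓕.functor i).obj Y ⟶ Z)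
    (b : (𝓕.functor j).obj X ⟶ Y) : (𝓕.functor l).obj X ⟶ Z :=
  (𝓕.η i j l h).hom.app X ≫ (𝓕.functor i).map b ≫ a

theorem one_star {X Y : C} {j : ℤ} (b : (𝓕.functor j).obj X ⟶ Y) :
    star 𝓕 j (zero_add j) (𝓕.zero.hom.app Y) b = b := by
  have h := 𝓕.zero.hom.naturality b
  dsimp only [Functor.id_map] at h
  unfold star
  rw [h]
  exact (Category.assoc _ _ _).symm.trans
    ((congrArg (fun f => f ≫ b) (𝓕.η_zero_left j X)).trans (Category.id_comp b))

theorem star_one {X Y : C} {i : ℤ} (a : (𝓕.functor i).obj X ⟶ Y) :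
    star 𝓕 i (add_zero i) a (𝓕.zero.hom.app X) = a :=
  (Category.assoc _ _ _).symm.trans
    ((congrArg (fun f => f ≫ a) (𝓕.η_zero_right i X)).trans (Category.id_comp a))

theorem star_assoc {X Y Z W : C} {i j l : ℤ} (a : (𝓕.functor i).obj Z ⟶ W)
    (b : (𝓕.functor j).obj Y ⟶ Z) (c : (𝓕.functor l).obj X ⟶ Y) :
    star 𝓕 (i + j + l) rfl (star 𝓕 (i + j) rfl a b) c =
      star 𝓕 (i + j + l) (add_assoc i j l).symm a (star 𝓕 (j + l) rfl b c) := by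
  have h := 𝓕.η_assoc i j l _ _ _ rfl rfl (add_assoc i j l).symm rfl X
  have h' := (𝓕.η i j (i + j) rfl).hom.naturality c
  dsimp only [Functor.comp_map, Functor.comp_obj] at h h'
  simp only [star, Functor.map_comp, Category.assoc]
  rw [reassoc_of% h, reassoc_of% h']

/-- The product as a bilinear map. -/
def starBilin (X Y Z : C) (i j : ℤ) : ((𝓕.functor j).obj X ⟶ Y) →ₗ[k]
    ((𝓕.functor i).obj Y ⟶ Z) →ₗ[k] ((𝓕.functor (i + j)).obj X ⟶ Z) :=
  LinearMap.mk₂ k (fun b a => star 𝓕 (i + j) rfl a b)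
    (fun _ _ _ => by simp only [star, Functor.map_add, Preadditive.add_comp, Preadditive.comp_add])
    (fun _ _ _ => by simp only [star, Functor.map_smul, Linear.smul_comp, Linear.comp_smul])
    (fun _ _ _ => by simp only [star, Preadditive.comp_add])
    (fun _ _ _ => by simp only [star, Linear.comp_smul])

/-- The morphisms of the orbit category. -/
abbrev OHom (X Y : C) : Type v := ⨁ n : ℤ, ((𝓕.functor n).obj X ⟶ Y)

/-- A morphism of degree `n` of the orbit category. -/
def mk {X Y : C} (n : ℤ) : ((𝓕.functor n).obj X ⟶ Y) →ₗ[k] OHom 𝓕 X Y :=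
  DirectSum.lof k ℤ (fun n => (𝓕.functor n).obj X ⟶ Y) n

/-- Composition in the orbit category. -/
def comp (X Y Z : C) : OHom 𝓕 X Y →ₗ[k] OHom 𝓕 Y Z →ₗ[k] OHom 𝓕 X Z :=
  DirectSum.toModule k ℤ _ fun j => LinearMap.flip <| DirectSum.toModule k ℤ _ fun i =>
    LinearMap.flip <| (starBilin 𝓕 X Y Z i j).compr₂ (mk 𝓕 (i + j))

theorem comp_mk {X Y Z : C} {i j : ℤ} (l : ℤ) (h : i + j = l) (b : (𝓕.functor j).obj X ⟶ Y)
    (a : (𝓕.functor i).obj Y ⟶ Z) :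
    comp 𝓕 X Y Z (mk 𝓕 j b) (mk 𝓕 i a) = mk 𝓕 l (star 𝓕 l h a b) := by
  subst h
  simp only [comp, mk, toModule_lof, LinearMap.flip_apply, LinearMap.compr₂_apply]
  rfl

theorem hom_induction {X Y : C} {p : OHom 𝓕 X Y → Prop} (f : OHom 𝓕 X Y) (zero : p 0)
    (mk : ∀ n a, p (mk 𝓕 n a)) (add : ∀ f g, p f → p g → p (f + g)) : p f :=
  DirectSum.induction_on f zero mk add

instance : Category.{v} (Orb 𝓕) where
  Hom X Y := OHom 𝓕 X.obj Y.obj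
  id X := mk 𝓕 0 (𝓕.zero.hom.app X.obj)
  comp {X Y Z} f g := comp 𝓕 X.obj Y.obj Z.obj f g
  id_comp {X Y} f := by
    induction f using hom_induction with
    | zero => exact map_zero _
    | mk n a => rw [comp_mk 𝓕 n (add_zero n), star_one]
    | add f g hf hg => exact (map_add _ f g).trans (congrArg₂ _ hf hg)
  comp_id {X Y} f := by
    induction f using hom_induction with
    | zero => simp
    | mk n a => rw [comp_mk 𝓕 n (zero_add n), one_star]
    | add f g hf hg => simp only [map_add, LinearMap.add_apply, hf, hg]
  assoc {X Y Z W} f g h := by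
    induction f using hom_induction with
    | zero => simp
    | add f g hf hg => simp only [map_add, LinearMap.add_apply, hf, hg]
    | mk l c =>
      induction g using hom_induction with
      | zero => simp
      | add f g hf hg => simp only [map_add, LinearMap.add_apply, hf, hg]
      | mk j b =>
        induction h using hom_induction with
        | zero => simp
        | add f g hf hg => simp only [map_add, hf, hg]
        | mk i a =>
          rw [comp_mk 𝓕 (j + l) rfl, comp_mk 𝓕 (i + j) rfl, comp_mk 𝓕 (i + j + l) rfl,
            comp_mk 𝓕 (i + j + l) (add_assoc i j l).symm, star_assoc]

instance (X Y : Orb 𝓕) : AddCommGroup (X ⟶ Y) := inferInstanceAs (AddCommGroup (OHom 𝓕 X.obj Y.obj))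

instance : Preadditive (Orb 𝓕) where
  add_comp X Y Z f f' g := by
    exact (congrArg (fun t => t g) (map_add (comp 𝓕 X.obj Y.obj Z.obj) f f'))
  comp_add X Y Z f g g' := map_add (comp 𝓕 X.obj Y.obj Z.obj f) g g'

instance (X Y : Orb 𝓕) : Module k (X ⟶ Y) := inferInstanceAs (Module k (OHom 𝓕 X.obj Y.obj))

instance : Linear k (Orb 𝓕) where
  smul_comp X Y Z c f g := by
    exact (congrArg (fun t => t g) (map_smul (comp 𝓕 X.obj Y.obj Z.obj) c f))
  comp_smul X Y Z f c g := map_smul (comp 𝓕 X.obj Y.obj Z.obj f) c g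

/-- The morphism of degree `n` of the orbit category given by a morphism `F_n X ⟶ Y`. -/
def hom {X Y : C} (n : ℤ) : ((𝓕.functor n).obj X ⟶ Y) →ₗ[k]
    ((of X : Orb 𝓕) ⟶ (of Y : Orb 𝓕)) := mk 𝓕 n

/-- The component of degree `n` of a morphism of the orbit category. -/
def coeff {X Y : C} (n : ℤ) : ((of X : Orb 𝓕) ⟶ (of Y : Orb 𝓕)) →ₗ[k]
    ((𝓕.functor n).obj X ⟶ Y) :=
  DirectSum.component k ℤ (fun n => (𝓕.functor n).obj X ⟶ Y) n

variable {𝓕}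

theorem hom_comp {X Y Z : C} {i j : ℤ} (l : ℤ) (h : i + j = l) (b : (𝓕.functor j).obj X ⟶ Y)
    (a : (𝓕.functor i).obj Y ⟶ Z) :
    hom 𝓕 j b ≫ hom 𝓕 i a = hom 𝓕 l (star 𝓕 l h a b) := comp_mk 𝓕 l h b a

theorem id_eq (X : C) : 𝟙 (of X : Orb 𝓕) = hom 𝓕 0 (𝓕.zero.hom.app X) := rfl

theorem coeff_hom {X Y : C} (n : ℤ) (a : (𝓕.functor n).obj X ⟶ Y) :
    coeff 𝓕 n (hom 𝓕 n a) = a := 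
  DirectSum.component.lof_self k (M := fun n => (𝓕.functor n).obj X ⟶ Y) n a

theorem coeff_hom_ne {X Y : C} {n m : ℤ} (h : n ≠ m) (a : (𝓕.functor n).obj X ⟶ Y) :
    coeff 𝓕 m (hom 𝓕 n a) = 0 :=
  DirectSum.of_eq_of_ne (β := fun n => (𝓕.functor n).obj X ⟶ Y) n m a h.symm

theorem hom_injective {X Y : C} (n : ℤ) :
    Function.Injective (hom 𝓕 n : ((𝓕.functor n).obj X ⟶ Y) →ₗ[k] _) :=
  Function.LeftInverse.injective (coeff_hom n)

theorem ext_coeff {X Y : C} {f g : (of X : Orb 𝓕) ⟶ of Y} (h : ∀ n, coeff 𝓕 n f = coeff 𝓕 n g) :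
    f = g := DFinsupp.ext h

theorem induction {X Y : C} {p : ((of X : Orb 𝓕) ⟶ of Y) → Prop} (f : (of X : Orb 𝓕) ⟶ of Y)
    (zero : p 0) (hom : ∀ n a, p (hom 𝓕 n a)) (add : ∀ f g, p f → p g → p (f + g)) : p f :=
  DirectSum.induction_on f zero hom add

variable (𝓕)

/-- The morphisms of degree `n`. -/
def deg (X Y : C) (n : ℤ) : Submodule k ((of X : Orb 𝓕) ⟶ of Y) := LinearMap.range (hom 𝓕 n)

variable {𝓕}

theorem hom_mem_deg {X Y : C} (n : ℤ) (a : (𝓕.functor n).obj X ⟶ Y) :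
    hom 𝓕 n a ∈ deg 𝓕 X Y n := ⟨a, rfl⟩

theorem comp_mem_deg {X Y Z : C} {i j l : ℤ} (h : i + j = l) {f : (of X : Orb 𝓕) ⟶ of Y}
    {g : (of Y : Orb 𝓕) ⟶ of Z} (hf : f ∈ deg 𝓕 X Y j) (hg : g ∈ deg 𝓕 Y Z i) :
    f ≫ g ∈ deg 𝓕 X Z l := by
  obtain ⟨b, rfl⟩ := hf
  obtain ⟨a, rfl⟩ := hg
  rw [hom_comp l h]
  exact hom_mem_deg _ _

theorem isInternal_deg (X Y : C) : DirectSum.IsInternal (deg 𝓕 X Y) := by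
  refine GrMod.isInternal_of_proj _ (fun i => (hom 𝓕 i).comp (coeff 𝓕 i)) ?_ ?_ ?_
  · rintro i _ ⟨a, rfl⟩
    simp only [LinearMap.comp_apply, coeff_hom]
  · rintro i j h _ ⟨a, rfl⟩
    simp only [LinearMap.comp_apply, coeff_hom_ne h, map_zero]
  · intro f
    induction f using induction with
    | zero => exact zero_mem _
    | hom n a => exact Submodule.mem_iSup_of_mem n (hom_mem_deg n a)
    | add f g hf hg => exact add_mem hf hg

variable (𝓕)

/-- The morphisms of the original category as morphisms of degree zero of the orbit category. -/
def inc {X Y : C} : (X ⟶ Y) →ₗ[k] ((of X : Orb 𝓕) ⟶ of Y) :=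
  (hom 𝓕 0).comp (Linear.leftComp k Y (𝓕.zero.hom.app X))

variable {𝓕}

theorem inc_apply {X Y : C} (f : X ⟶ Y) : inc 𝓕 f = hom 𝓕 0 (𝓕.zero.hom.app X ≫ f) := rfl

theorem inc_mem_deg {X Y : C} (f : X ⟶ Y) : inc 𝓕 f ∈ deg 𝓕 X Y 0 := hom_mem_deg _ _

@[simp]
theorem hom_comp_inc {X Y Z : C} {j : ℤ} (b : (𝓕.functor j).obj X ⟶ Y) (f : Y ⟶ Z) :
    hom 𝓕 j b ≫ inc 𝓕 f = hom 𝓕 j (b ≫ f) := by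
  rw [inc_apply, hom_comp j (zero_add j)]
  congr 1
  have h := 𝓕.zero.hom.naturality b
  dsimp only [Functor.id_map] at h
  unfold star
  rw [reassoc_of% h]
  have h' := 𝓕.η_zero_left j X
  rw [reassoc_of% h']

@[simp]
theorem inc_comp_hom {X Y Z : C} {j : ℤ} (f : X ⟶ Y) (b : (𝓕.functor j).obj Y ⟶ Z) :
    inc 𝓕 f ≫ hom 𝓕 j b = hom 𝓕 j ((𝓕.functor j).map f ≫ b) := by
  rw [inc_apply, hom_comp j (add_zero j)]
  congr 1
  unfold star
  have h' := 𝓕.η_zero_right j X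
  rw [Functor.map_comp, Category.assoc, reassoc_of% h']

@[simp]
theorem inc_id (X : C) : inc 𝓕 (𝟙 X) = 𝟙 (of X : Orb 𝓕) := by
  exact congrArg (hom 𝓕 0) (Category.comp_id _)

theorem inc_comp {X Y Z : C} (f : X ⟶ Y) (g : Y ⟶ Z) :
    inc 𝓕 (f ≫ g) = inc 𝓕 f ≫ inc 𝓕 g := by
  rw [inc_apply f, hom_comp_inc, inc_apply, Category.assoc]

theorem coeff_comp_inc {X Y Z : C} (n : ℤ) (f : (of X : Orb 𝓕) ⟶ of Y) (g : Y ⟶ Z) :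
    coeff 𝓕 n (f ≫ inc 𝓕 g) = coeff 𝓕 n f ≫ g := by
  induction f using induction with
  | zero => simp
  | add f f' h h' => simp only [Preadditive.add_comp, map_add, h, h']
  | hom m a =>
    rw [hom_comp_inc]
    obtain rfl | h := eq_or_ne m n
    · rw [coeff_hom, coeff_hom]
    · rw [coeff_hom_ne h, coeff_hom_ne h, Limits.zero_comp]

variable (𝓕)

/-- The isomorphism `X ≅ F_n X` of degree `n` in the orbit category. -/
def twist (X : C) (n : ℤ) : (of X : Orb 𝓕) ≅ of ((𝓕.functor n).obj X) where
  hom := hom 𝓕 n (𝟙 _)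
  inv := hom 𝓕 (-n) ((𝓕.η (-n) n 0 (neg_add_cancel n)).inv.app X ≫ 𝓕.zero.hom.app X)
  hom_inv_id := by
    rw [hom_comp 0 (neg_add_cancel n), id_eq]
    congr 1
    simp [star]
  inv_hom_id := by
    rw [hom_comp 0 (add_neg_cancel n), id_eq]
    congr 1
    simp only [star, Category.comp_id, Functor.map_comp]
    -- The other composite cancels at once, as η^{-n,n} meets its inverse directly. Here η^{n,-n}
    -- occurs instead, and associativity for (n, -n, n) trades it for F_n(η^{-n,n}); both unit
    -- axioms finish.
    have h := 𝓕.η_assoc n (-n) n 0 0 n (add_neg_cancel n) (neg_add_cancel n) (add_zero n)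
      (zero_add n) X
    rw [← cancel_epi ((𝓕.η 0 n n (zero_add n)).hom.app X), ← reassoc_of% h, ← Functor.map_comp_assoc,
      Iso.hom_inv_id_app]
    simpa using (𝓕.η_zero_right n X).trans (𝓕.η_zero_left n X).symm

theorem twist_hom (X : C) (n : ℤ) : (twist 𝓕 X n).hom = hom 𝓕 n (𝟙 _) := rfl

theorem twist_hom_mem_deg (X : C) (n : ℤ) : (twist 𝓕 X n).hom ∈ deg 𝓕 _ _ n := hom_mem_deg _ _

theorem twist_inv_mem_deg (X : C) (n : ℤ) : (twist 𝓕 X n).inv ∈ deg 𝓕 _ _ (-n) := hom_mem_deg _ _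

theorem twist_naturality {X Y : C} (f : X ⟶ Y) (n : ℤ) :
    (twist 𝓕 X n).hom ≫ inc 𝓕 ((𝓕.functor n).map f) =
      inc 𝓕 f ≫ (twist 𝓕 Y n).hom := by
  rw [twist_hom, twist_hom, hom_comp_inc, inc_comp_hom, Category.id_comp, Category.comp_id]

variable {𝓕}

/-- The morphisms of degree `n` are the composites of the isomorphism `X ≅ F_n X` with morphisms of
the original category. -/
theorem twist_hom_comp_inc {X Y : C} (n : ℤ) (f : (𝓕.functor n).obj X ⟶ Y) :
    (twist 𝓕 X n).hom ≫ inc 𝓕 f = hom 𝓕 n f := by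
  rw [twist_hom, hom_comp_inc, Category.id_comp]

end Orb

end Orbit

/-! ### The graded module of morphisms in the orbit category -/

section HomModule

variable {k : Type w} [CommRing k] {C : Type u} [Category.{v} C] [Preadditive C] [Linear k C]
  {F : Autoequivalence k C}

namespace TwistedEnd

variable (𝓕 : ZSequence F) (P : C)

/-- The twisted endomorphism ring consists of the endomorphisms in the orbit category. -/
def toOrb : TwistedEnd 𝓕 P ≃ₗ[k] ((Orb.of P : Orb 𝓕) ⟶ Orb.of P) :=
  LinearEquiv.refl k (⨁ n : ℤ, TwistedEndPiece 𝓕 P n)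

variable {𝓕 P}

/-- The homogeneous element given by `a : F_n P ⟶ P`. -/
def single (n : ℤ) : ((𝓕.functor n).obj P ⟶ P) →ₗ[k] TwistedEnd 𝓕 P :=
  DirectSum.lof k ℤ (TwistedEndPiece 𝓕 P) n

theorem toOrb_single (n : ℤ) (a : (𝓕.functor n).obj P ⟶ P) :
    toOrb 𝓕 P (single n a) = Orb.hom 𝓕 n a := rfl

theorem induction {p : TwistedEnd 𝓕 P → Prop} (t : TwistedEnd 𝓕 P) (zero : p 0)
    (single : ∀ n a, p (single n a)) (add : ∀ x y, p x → p y → p (x + y)) : p t :=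
  DirectSum.induction_on t zero single add

theorem toOrb_one : toOrb 𝓕 P 1 = 𝟙 (Orb.of P : Orb 𝓕) := rfl

theorem single_mul_single {i j : ℤ} (a : (𝓕.functor i).obj P ⟶ P)
    (b : (𝓕.functor j).obj P ⟶ P) :
    single i a * single j b = single (i + j) (TwistedEndPiece.mulAt 𝓕 P (i + j) rfl a b) :=
  DirectSum.of_mul_of (A := TwistedEndPiece 𝓕 P) a b

/-- The order is reversed because `≫` is diagrammatic while ⋆ follows composition of functions. This
is why precomposition makes the morphisms out of `P` a right module. -/
theorem toOrb_mul (t u : TwistedEnd 𝓕 P) :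
    toOrb 𝓕 P (t * u) = toOrb 𝓕 P u ≫ toOrb 𝓕 P t := by
  induction t using induction with
  | zero => rw [zero_mul, map_zero, Limits.comp_zero]
  | add x y hx hy => rw [add_mul, map_add, hx, hy, map_add, Preadditive.comp_add]
  | single i a =>
    induction u using induction with
    | zero => rw [mul_zero, map_zero, Limits.zero_comp]
    | add x y hx hy => rw [mul_add, map_add, hx, hy, map_add, Preadditive.add_comp]
    | single j b =>
      rw [single_mul_single, toOrb_single, toOrb_single, toOrb_single, Orb.hom_comp (i + j) rfl]
      rfl

theorem toOrb_mem_deg {n : ℤ} {t : TwistedEnd 𝓕 P} :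
    toOrb 𝓕 P t ∈ Orb.deg 𝓕 P P n ↔ t ∈ deg 𝓕 P n := Iff.rfl

end TwistedEnd

namespace Orb

open TwistedEnd MulOpposite

variable {𝓕 : ZSequence F} {P : C}

instance (X : Orb 𝓕) : Module (TwistedEnd 𝓕 P)ᵐᵒᵖ ((of P : Orb 𝓕) ⟶ X) where
  smul t q := toOrb 𝓕 P t.unop ≫ q
  one_smul q := Category.id_comp q
  mul_smul t u q := by
    change toOrb 𝓕 P (u.unop * t.unop) ≫ q = _
    rw [toOrb_mul, Category.assoc]
    rfl
  smul_zero _ := Limits.comp_zero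
  smul_add _ _ _ := Preadditive.comp_add _ _ _ _ _ _
  add_smul t u q := by
    change toOrb 𝓕 P (t.unop + u.unop) ≫ q = _
    rw [map_add, Preadditive.add_comp]
    rfl
  zero_smul q := by
    change toOrb 𝓕 P 0 ≫ q = 0
    rw [map_zero, Limits.zero_comp]

theorem op_smul {X : Orb 𝓕} (t : TwistedEnd 𝓕 P) (q : (of P : Orb 𝓕) ⟶ X) :
    op t • q = toOrb 𝓕 P t ≫ q := rfl

theorem smul_def {X : Orb 𝓕} (t : (TwistedEnd 𝓕 P)ᵐᵒᵖ) (q : (of P : Orb 𝓕) ⟶ X) :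
    t • q = toOrb 𝓕 P t.unop ≫ q := rfl

instance (X : Orb 𝓕) : IsScalarTower k (TwistedEnd 𝓕 P)ᵐᵒᵖ ((of P : Orb 𝓕) ⟶ X) where
  smul_assoc c t q := by
    rw [smul_def, smul_def, unop_smul, map_smul, Linear.smul_comp]

/-- Composition with a morphism of the orbit category. -/
def postcomp (P : C) {X Y : C} (c : (of X : Orb 𝓕) ⟶ of Y) :
    ((of P : Orb 𝓕) ⟶ of X) →ₗ[(TwistedEnd 𝓕 P)ᵐᵒᵖ] ((of P : Orb 𝓕) ⟶ of Y) where
  toFun q := q ≫ c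
  map_add' q q' := Preadditive.add_comp _ _ _ q q' c
  map_smul' _ _ := Category.assoc _ _ _

@[simp]
theorem postcomp_apply {X Y : C} (c : (of X : Orb 𝓕) ⟶ of Y) (q : (of P : Orb 𝓕) ⟶ of X) :
    postcomp P c q = q ≫ c := rfl

variable (𝓕 P)

/-- The graded module `⨁ n, hom(F_n P, X)` over the twisted endomorphism ring of `P`. -/
def homModule (X : C) : GrMod (TwistedEnd.deg 𝓕 P) where
  carrier := (of P : Orb 𝓕) ⟶ of X
  deg := Orb.deg 𝓕 P X
  isInternal := isInternal_deg P X
  smul_mem i j _ _ hq ht := comp_mem_deg (rfl : i + j = i + j) (toOrb_mem_deg.2 ht) hq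

/-- The functor `X ↦ ⨁ n, hom(F_n P, X)`. -/
def homFunctor : C ⥤ GrMod (TwistedEnd.deg 𝓕 P) where
  obj := homModule 𝓕 P
  map {X Y} f := GrMod.ofLin (M := homModule 𝓕 P X) (N := homModule 𝓕 P Y)
    (postcomp P (inc 𝓕 f)) fun i _ hq => comp_mem_deg (zero_add i) hq (inc_mem_deg f)
  map_id X := GrMod.hom_ext fun (q : (of P : Orb 𝓕) ⟶ of X) => by
    change q ≫ inc 𝓕 (𝟙 X) = q
    rw [inc_id, Category.comp_id]
  map_comp {X Y Z} f g := GrMod.hom_ext fun (q : (of P : Orb 𝓕) ⟶ of X) => by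
    change q ≫ inc 𝓕 (f ≫ g) = (q ≫ inc 𝓕 f) ≫ inc 𝓕 g
    rw [inc_comp, Category.assoc]

variable {𝓕 P}

theorem lin_homFunctor_map {X Y : C} (f : X ⟶ Y) (q : (of P : Orb 𝓕) ⟶ of X) :
    GrMod.lin ((homFunctor 𝓕 P).map f) q = q ≫ inc 𝓕 f := rfl

instance : (homFunctor 𝓕 P).Additive where
  map_add {X Y f g} := GrMod.hom_ext fun (q : (of P : Orb 𝓕) ⟶ of X) => by
    change q ≫ inc 𝓕 (f + g) = q ≫ inc 𝓕 f + q ≫ inc 𝓕 g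
    rw [map_add, Preadditive.comp_add]

instance : (homFunctor 𝓕 P).Linear k where
  map_smul {X Y} f c := GrMod.hom_ext fun (q : (of P : Orb 𝓕) ⟶ of X) => by
    change q ≫ inc 𝓕 (c • f) = c • (q ≫ inc 𝓕 f)
    rw [map_smul, Linear.comp_smul]

variable (𝓕 P) in
/-- The identity of `X` is a finite sum of composites of homogeneous morphisms `X ⟶ P ⟶ X` of
opposite degrees. -/
def IsSummand (X : C) : Prop :=
  𝟙 (of X : Orb 𝓕) ∈ AddSubgroup.closure {a : (of X : Orb 𝓕) ⟶ of X |
    ∃ n : ℤ, ∃ s ∈ Orb.deg 𝓕 X P (-n), ∃ f ∈ Orb.deg 𝓕 P X n, a = s ≫ f}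

/-- A composite X ⟶ F_n P ⟶ X in the original category is rerouted through P by inserting the
isomorphism P ≅ F_n P, which has degree n, and its inverse, of degree -n. -/
theorem IsSummand.of_factoring {X : C}
    (h : 𝟙 X ∈ factoring (fun j : Σ n, ((𝓕.functor n).obj P ⟶ X) => j.2) X) :
    IsSummand 𝓕 P X := by
  have key : ∀ a ∈ factoring (fun j : Σ n, ((𝓕.functor n).obj P ⟶ X) => j.2) X,
      inc 𝓕 a ∈ AddSubgroup.closure {a : (of X : Orb 𝓕) ⟶ of X |
        ∃ n : ℤ, ∃ s ∈ Orb.deg 𝓕 X P (-n), ∃ f ∈ Orb.deg 𝓕 P X n, a = s ≫ f} := by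
    intro a ha
    induction ha using AddSubgroup.closure_induction with
    | mem a ha =>
      obtain ⟨⟨n, x⟩, b, rfl⟩ := ha
      refine AddSubgroup.subset_closure ⟨n, inc 𝓕 b ≫ (twist 𝓕 P n).inv,
        comp_mem_deg (by ring) (inc_mem_deg b) (twist_inv_mem_deg 𝓕 P n),
        (twist 𝓕 P n).hom ≫ inc 𝓕 x,
        comp_mem_deg (by ring) (twist_hom_mem_deg 𝓕 P n) (inc_mem_deg x), ?_⟩
      rw [Category.assoc, Iso.inv_hom_id_assoc, inc_comp]
    | zero => rw [map_zero]; exact zero_mem _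
    | add x y _ _ hx hy => rw [map_add]; exact add_mem hx hy
    | neg x _ hx => rw [map_neg]; exact neg_mem hx
  have := key _ h
  rwa [inc_id] at this

namespace IsSummand

variable {X Y : C}

/-- With degrees forgotten, the pairs (s_i, f_i) form a dual basis, which is all that the ungraded
statements below require. -/
theorem exists_sum (h : IsSummand 𝓕 P X) : ∃ (N : ℕ) (s : Fin N → ((of X : Orb 𝓕) ⟶ of P))
    (f : Fin N → ((of P : Orb 𝓕) ⟶ of X)), ∑ i, s i ≫ f i = 𝟙 (of X : Orb 𝓕) := by
  unfold IsSummand at h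
  generalize 𝟙 (of X : Orb 𝓕) = z at h ⊢
  induction h using AddSubgroup.closure_induction with
  | mem a ha =>
    obtain ⟨n, s, -, f, -, rfl⟩ := ha
    exact ⟨1, fun _ => s, fun _ => f, by simp⟩
  | zero => exact ⟨0, Fin.elim0, Fin.elim0, by simp⟩
  | add x y _ _ hx hy =>
    obtain ⟨N, s, f, h⟩ := hx
    obtain ⟨N', s', f', h'⟩ := hy
    exact ⟨N + N', Fin.append s s', Fin.append f f', by simp [Fin.sum_univ_add, h, h']⟩
  | neg x _ hx =>
    obtain ⟨N, s, f, h⟩ := hx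
    exact ⟨N, fun i => -s i, f, by simp [h]⟩

theorem postcomp_injective (h : IsSummand 𝓕 P X) :
    Function.Injective (postcomp P : ((of X : Orb 𝓕) ⟶ of Y) → _) := by
  intro c c' e
  obtain ⟨N, s, f, hsf⟩ := h.exists_sum
  have e' : ∀ i, f i ≫ c = f i ≫ c' := fun i => LinearMap.congr_fun e (f i)
  rw [← Category.id_comp c, ← Category.id_comp c', ← hsf, Preadditive.sum_comp,
    Preadditive.sum_comp]
  simp only [Category.assoc, e']

/-- Every q equals ∑ (q s_i) f_i with q s_i in the ring, so linearity forces φ(q) = ∑ q s_i φ(f_i).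
Thus φ is composition with ∑ s_i φ(f_i). -/
theorem postcomp_surjective (h : IsSummand 𝓕 P X) :
    Function.Surjective (postcomp P : ((of X : Orb 𝓕) ⟶ of Y) → _) := by
  intro φ
  obtain ⟨N, s, f, hsf⟩ := h.exists_sum
  refine ⟨∑ i, s i ≫ φ (f i), LinearMap.ext fun q => ?_⟩
  have hq : ∀ i, q ≫ s i ≫ φ (f i) = φ (q ≫ s i ≫ f i) := fun i => by
    have := φ.map_smul (op ((toOrb 𝓕 P).symm (q ≫ s i))) (f i)
    simp only [op_smul, LinearEquiv.apply_symm_apply, Category.assoc] at this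
    exact this.symm
  rw [postcomp_apply, Preadditive.comp_sum, Finset.sum_congr rfl fun i _ => hq i, ← map_sum,
    ← Preadditive.comp_sum, hsf, Category.comp_id]

/-- Here the opposite degrees in `IsSummand` matter: `c` is a sum of terms s (f c) with s of degree
-m and f c of degree m + n. -/
theorem mem_deg (h : IsSummand 𝓕 P X) {c : (of X : Orb 𝓕) ⟶ of Y} {n : ℤ}
    (hc : ∀ i, ∀ q ∈ Orb.deg 𝓕 P X i, q ≫ c ∈ Orb.deg 𝓕 P Y (i + n)) :
    c ∈ Orb.deg 𝓕 X Y n := by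
  rw [← Category.id_comp c]
  unfold IsSummand at h
  generalize 𝟙 (of X : Orb 𝓕) = z at h ⊢
  induction h using AddSubgroup.closure_induction with
  | mem a ha =>
    obtain ⟨m, s, hs, f, hf, rfl⟩ := ha
    rw [Category.assoc]
    exact comp_mem_deg (by ring) hs (hc m f hf)
  | zero => rw [Limits.zero_comp]; exact zero_mem _
  | add x y _ _ hx hy => rw [Preadditive.add_comp]; exact add_mem hx hy
  | neg x _ hx => rw [Preadditive.neg_comp]; exact neg_mem hx

theorem finite (h : IsSummand 𝓕 P X) :
    Module.Finite (TwistedEnd 𝓕 P)ᵐᵒᵖ ((of P : Orb 𝓕) ⟶ of X) := by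
  obtain ⟨N, s, f, hsf⟩ := h.exists_sum
  refine ⟨Submodule.fg_def.2 ⟨Set.range f, Set.finite_range f, ?_⟩⟩
  rw [Submodule.eq_top_iff']
  intro q
  rw [← Category.comp_id q, ← hsf, Preadditive.comp_sum]
  refine Submodule.sum_mem _ fun i _ => ?_
  have : q ≫ s i ≫ f i = op ((toOrb 𝓕 P).symm (q ≫ s i)) • f i := by
    rw [op_smul, LinearEquiv.apply_symm_apply, Category.assoc]
  rw [this]
  exact Submodule.smul_mem _ _ (Submodule.subset_span ⟨i, rfl⟩)

/-- The linear form given by a morphism `X ⟶ P`. -/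
def linearForm (s : (of X : Orb 𝓕) ⟶ of P) :
    ((of P : Orb 𝓕) ⟶ of X) →ₗ[(TwistedEnd 𝓕 P)ᵐᵒᵖ] (TwistedEnd 𝓕 P)ᵐᵒᵖ where
  toFun q := op ((toOrb 𝓕 P).symm (q ≫ s))
  map_add' q q' := by rw [Preadditive.add_comp, map_add, MulOpposite.op_add]
  map_smul' t q := by
    refine unop_injective ((toOrb 𝓕 P).injective ?_)
    change _ = toOrb 𝓕 P ((toOrb 𝓕 P).symm (q ≫ s) * t.unop)
    rw [toOrb_mul, unop_op, LinearEquiv.apply_symm_apply, LinearEquiv.apply_symm_apply, smul_def,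
      Category.assoc]

theorem linearForm_smul (s : (of X : Orb 𝓕) ⟶ of P) (q : (of P : Orb 𝓕) ⟶ of X)
    (f : (of P : Orb 𝓕) ⟶ of Y) : linearForm s q • f = q ≫ s ≫ f := by
  change op ((toOrb 𝓕 P).symm (q ≫ s)) • f = _
  rw [op_smul, LinearEquiv.apply_symm_apply, Category.assoc]

/-- Dual basis lemma: the forms `linearForm (s i)` and the elements `f i` exhibit the module as a
direct summand of a finite free one. -/
theorem projective (h : IsSummand 𝓕 P X) :
    Module.Projective (TwistedEnd 𝓕 P)ᵐᵒᵖ ((of P : Orb 𝓕) ⟶ of X) := by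
  obtain ⟨N, s, f, hsf⟩ := h.exists_sum
  refine Module.Projective.of_split (M := Fin N → (TwistedEnd 𝓕 P)ᵐᵒᵖ)
    (LinearMap.pi fun i => linearForm (s i))
    (∑ i, (LinearMap.toSpanSingleton _ _ (f i)).comp (LinearMap.proj i)) ?_
  refine LinearMap.ext fun q => ?_
  simp only [LinearMap.comp_apply, LinearMap.sum_apply, LinearMap.proj_apply, LinearMap.pi_apply,
    LinearMap.toSpanSingleton_apply, linearForm_smul, LinearMap.id_apply]
  rw [← Preadditive.comp_sum, hsf, Category.comp_id]

/-- The roles are exchanged: now the identity of `P` factors through `X`, so 1 is a sum of values of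
linear forms on the module of `X`. Hence each element m of any module is a sum of values of linear
maps from the module of `X`, and such maps detect equality. -/
theorem isSeparator (h : IsSummand 𝓕 X P) :
    IsSeparator (ModuleCat.of.{v} (TwistedEnd 𝓕 P)ᵐᵒᵖ ((of P : Orb 𝓕) ⟶ of X)) := by
  rw [isSeparator_def]
  intro M N a b hab
  obtain ⟨n, t, g, htg⟩ := h.exists_sum
  have one : (1 : (TwistedEnd 𝓕 P)ᵐᵒᵖ) = ∑ i, linearForm (g i) (t i) := by
    refine unop_injective ((toOrb 𝓕 P).injective ?_)
    rw [unop_one, toOrb_one, ← htg, Finset.unop_sum, map_sum]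
    refine Finset.sum_congr rfl fun i _ => ?_
    exact ((toOrb 𝓕 P).apply_symm_apply _).symm
  refine ModuleCat.hom_ext (LinearMap.ext fun m => ?_)
  rw [← one_smul (TwistedEnd 𝓕 P)ᵐᵒᵖ m, one, Finset.sum_smul, map_sum, map_sum]
  refine Finset.sum_congr rfl fun i _ => ?_
  have := hab (ModuleCat.ofHom ((LinearMap.toSpanSingleton _ M m).comp (linearForm (g i))))
  exact LinearMap.congr_fun (congrArg ModuleCat.Hom.hom this) (t i)

/-- The twisted endomorphism ring of `X` is the endomorphism ring of the graded module of `X`. -/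
noncomputable def endEquiv (h : IsSummand 𝓕 P X) :
    TwistedEnd 𝓕 X ≃ₐ[k] Module.End (TwistedEnd 𝓕 P)ᵐᵒᵖ (homModule 𝓕 P X).carrier :=
  AlgEquiv.ofBijective
    (AlgHom.ofLinearMap
      { toFun := fun t => postcomp P (toOrb 𝓕 X t)
        map_add' := fun t u => LinearMap.ext fun (q : (of P : Orb 𝓕) ⟶ of X) => by
          change q ≫ toOrb 𝓕 X (t + u) = q ≫ toOrb 𝓕 X t + q ≫ toOrb 𝓕 X u
          rw [map_add, Preadditive.comp_add]
        map_smul' := fun c t => LinearMap.ext fun (q : (of P : Orb 𝓕) ⟶ of X) => by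
          change q ≫ toOrb 𝓕 X (c • t) = c • (q ≫ toOrb 𝓕 X t)
          rw [map_smul, Linear.comp_smul] }
      (LinearMap.ext fun (q : (of P : Orb 𝓕) ⟶ of X) => Category.comp_id q)
      fun t u => LinearMap.ext fun (q : (of P : Orb 𝓕) ⟶ of X) => by
        change q ≫ toOrb 𝓕 X (t * u) = (q ≫ toOrb 𝓕 X u) ≫ toOrb 𝓕 X t
        rw [toOrb_mul, Category.assoc])
    (Function.Bijective.comp ⟨h.postcomp_injective, h.postcomp_surjective⟩
      (toOrb 𝓕 X).bijective)

theorem endEquiv_mem (h : IsSummand 𝓕 P X) (n : ℤ) (t : TwistedEnd 𝓕 X) :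
    t ∈ TwistedEnd.deg 𝓕 X n ↔
      h.endEquiv t ∈ GrMod.homDeg (homModule 𝓕 P X) (homModule 𝓕 P X) n := by
  constructor
  · intro ht i q hq
    exact comp_mem_deg (add_comm n i) hq (toOrb_mem_deg.2 ht)
  · intro ht
    exact toOrb_mem_deg.1 (h.mem_deg ht)

end IsSummand

end Orb

end HomModule

/-! ### Factoring through sums of ranges and comparing kernels -/

namespace GrMod

variable {k : Type w} [CommRing k] {R : Type u} [Ring R] [Algebra k R] {𝒜 : ℤ → Submodule k R}

theorem lin_dsumDesc {ι : Type u} {Z : ι → GrMod 𝒜} {A : GrMod 𝒜} (x : ∀ j, Z j ⟶ A) (j : ι)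
    (z : (Z j).carrier) : lin (dsumDesc Z x) (lin (dsumι Z j) z) = lin (x j) z :=
  congrArg (fun f => lin f z) (dsumι_desc x j)

theorem jointlyEpi_dsumι {ι : Type u} (Z : ι → GrMod 𝒜) : JointlyEpi (dsumι Z) :=
  fun _ _ _ h => dsum_hom_ext h

theorem jointlyEpi_subLift {ι : Type*} {Z : ι → GrMod 𝒜} {A : GrMod 𝒜} (x : ∀ j, Z j ⟶ A) :
    JointlyEpi fun j => subLift (⨆ j, LinearMap.range (lin (x j))) (isHomogeneous_iSup_range x)
      (x j) fun z => Submodule.mem_iSup_of_mem (p := fun j => LinearMap.range (lin (x j))) j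
        (LinearMap.mem_range_self _ z) := by
  intro B f g h
  have key : ∀ a (ha : a ∈ ⨆ j, LinearMap.range (lin (x j))),
      lin f (⟨a, ha⟩ : ↥(⨆ j, LinearMap.range (lin (x j)))) =
        lin g (⟨a, ha⟩ : ↥(⨆ j, LinearMap.range (lin (x j)))) := by
    intro a ha
    induction ha using Submodule.iSup_induction' with
    | mem j m hm =>
      obtain ⟨z, rfl⟩ := hm
      exact congrArg (fun t => lin t z) (h j)
    | zero => exact (map_zero (lin f)).trans (map_zero (lin g)).symm
    | add a b ha hb iha ihb =>
      exact ((lin f).map_add ⟨a, ha⟩ ⟨b, hb⟩).trans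
        ((congrArg₂ _ iha ihb).trans ((lin g).map_add ⟨a, ha⟩ ⟨b, hb⟩).symm)
  exact hom_ext fun a => key a.1 a.2

/-- A morphism from a compact projective object whose range is contained in the sum of the ranges
of a family is a finite sum of morphisms that factor through the members of the family. -/
theorem mem_factoring_of_mem_iSup_range {ι : Type u} {Z : ι → GrMod 𝒜} {A Y : GrMod 𝒜}
    (hY : IsCompactProjective Y) (x : ∀ j, Z j ⟶ A) (a : Y ⟶ A)
    (ha : ∀ y, lin a y ∈ ⨆ j, LinearMap.range (lin (x j))) : a ∈ factoring x Y := by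
  have h := hY _ _ _ (jointlyEpi_subLift x) (subLift _ (isHomogeneous_iSup_range x) a ha)
  rw [← subLift_ι _ (isHomogeneous_iSup_range x) a ha]
  generalize subLift _ (isHomogeneous_iSup_range x) a ha = a' at h ⊢
  induction h using AddSubgroup.closure_induction with
  | mem b hb =>
    obtain ⟨j, b, rfl⟩ := hb
    rw [Category.assoc, subLift_ι]
    exact comp_mem_factoring x j b
  | zero => rw [Limits.zero_comp]; exact zero_mem _
  | add b b' _ _ h h' => rw [Preadditive.add_comp]; exact add_mem h h'
  | neg b _ h => rw [Preadditive.neg_comp]; exact neg_mem h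

theorem ker_eq_of_homogeneous {A M N : GrMod 𝒜} (f : A ⟶ M) (g : A ⟶ N)
    (h : ∀ i, ∀ a ∈ A.deg i, lin f a = 0 ↔ lin g a = 0) (a : A.carrier) :
    lin f a = 0 ↔ lin g a = 0 := by
  constructor
  · intro ha
    refine N.eq_zero_of_proj fun i => ?_
    rw [← lin_proj, ← h i _ (A.proj_mem i a), lin_proj, ha, map_zero]
  · intro ha
    refine M.eq_zero_of_proj fun i => ?_
    rw [← lin_proj, h i _ (A.proj_mem i a), lin_proj, ha, map_zero]

end GrMod

/-! ### The functor `X ↦ ⨁ n, hom(F_n P, X)` is an equivalence -/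

namespace Orb

open TwistedEnd MulOpposite GrMod

section

variable {k : Type w} [CommRing k] {C : Type u} [Category.{v} C] [Preadditive C] [Linear k C]
  {F : Autoequivalence k C} {𝓕 : ZSequence F} {P : C}

/-- Through P ≅ F_n P, the morphism `b` becomes a ring element of degree l - n, and precomposition
with `b` becomes its action. This is how linearity over the twisted ring controls morphisms between
the F_n P. -/
theorem hom_comp_eq_smul {X : C} {l n : ℤ} (b : (𝓕.functor l).obj P ⟶ (𝓕.functor n).obj P)
    (x : (𝓕.functor n).obj P ⟶ X) :
    hom 𝓕 l (b ≫ x) = op ((toOrb 𝓕 P).symm (hom 𝓕 l b ≫ (twist 𝓕 P n).inv)) • hom 𝓕 n x := by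
  rw [op_smul, LinearEquiv.apply_symm_apply, Category.assoc, ← twist_hom_comp_inc n x,
    Iso.inv_hom_id_assoc, hom_comp_inc]

theorem hom_coeff_of_mem_deg {X Y : C} {n : ℤ} {f : (of X : Orb 𝓕) ⟶ of Y}
    (hf : f ∈ Orb.deg 𝓕 X Y n) : hom 𝓕 n (coeff 𝓕 n f) = f := by
  obtain ⟨a, rfl⟩ := hf
  rw [coeff_hom]

theorem homFunctor_faithful
    (hgen : (ObjectProperty.ofObj fun n => (𝓕.functor n).obj P).IsSeparating) :
    (homFunctor 𝓕 P).Faithful where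
  map_injective {X Y f g} h := by
    refine (isSeparating_iff_jointlyEpi _).1 hgen X f g fun j => hom_injective j.1 ?_
    have := congrArg (fun t => lin t (hom 𝓕 j.1 j.2)) h
    simp only [lin_homFunctor_map, hom_comp_inc] at this
    exact this

variable (𝓕 P) in
/-- The isomorphism between the module of `X` and the shift of the module of `F_1 X`. -/
noncomputable def homFunctorShift :
    homFunctor 𝓕 P ≅ 𝓕.functor 1 ⋙ homFunctor 𝓕 P ⋙ shift (TwistedEnd.deg 𝓕 P) :=
  NatIso.ofComponents
    (fun X => isoOfBijective (M := homModule 𝓕 P X)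
      (N := shiftObj (homModule 𝓕 P ((𝓕.functor 1).obj X)))
      ⟨postcomp P (twist 𝓕 X 1).hom,
        -- Composing with the twist raises the degree from i to i + 1, which is degree i of the
        -- shift.
        fun i _ hq => comp_mem_deg (add_comm 1 i) hq (twist_hom_mem_deg 𝓕 X 1)⟩
      ⟨fun q q' h => (cancel_mono (twist 𝓕 X 1).hom).1 h,
        fun (q : (of P : Orb 𝓕) ⟶ of ((𝓕.functor 1).obj X)) => ⟨q ≫ (twist 𝓕 X 1).inv, by
          change (q ≫ (twist 𝓕 X 1).inv) ≫ (twist 𝓕 X 1).hom = q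
          rw [Category.assoc, Iso.inv_hom_id, Category.comp_id]⟩⟩)
    fun {X Y} f => hom_ext fun (q : (of P : Orb 𝓕) ⟶ of X) => by
      change (q ≫ inc 𝓕 f) ≫ (twist 𝓕 Y 1).hom =
        (q ≫ (twist 𝓕 X 1).hom) ≫ inc 𝓕 ((𝓕.functor 1).map f)
      rw [Category.assoc, Category.assoc, twist_naturality]

end

variable {k : Type w} [CommRing k] {R : Type u} [Ring R] [Algebra k R] {𝒜 : ℤ → Submodule k R}
  {F : Autoequivalence k (GrMod 𝒜)} {𝓕 : ZSequence F} {P : GrMod 𝒜}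

/-- The map φ sends each x : F_n P ⟶ X to a morphism c n x : F_n P ⟶ Y. Since X is a quotient of the
direct sum of the F_n P over all pairs (n, x), it suffices that the morphism ψ assembled from the c
n x vanishes on the relations. -/
theorem homFunctor_full (hP : IsCompactProjective P)
    (hgen : (ObjectProperty.ofObj fun n => (𝓕.functor n).obj P).IsSeparating) :
    (homFunctor 𝓕 P).Full where
  map_surjective {X Y} φ := by
    have hgen' := (isSeparating_iff_jointlyEpi _).1 hgen
    let c : ∀ n, ((𝓕.functor n).obj P ⟶ X) → ((𝓕.functor n).obj P ⟶ Y) :=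
      fun n x => coeff 𝓕 n (lin φ (hom 𝓕 n x))
    have hc : ∀ n x, hom 𝓕 n (c n x) = lin φ (hom 𝓕 n x) := fun n x =>
      hom_coeff_of_mem_deg (lin_mem φ (hom_mem_deg n x))
    let Z : (Σ n, ((𝓕.functor n).obj P ⟶ X)) → GrMod 𝒜 := fun j => (𝓕.functor j.1).obj P
    let π : dsum Z ⟶ X := dsumDesc Z fun j => j.2
    let ψ : dsum Z ⟶ Y := dsumDesc Z fun j => c j.1 j.2
    have hπ : Function.Surjective (lin π) := dsumDesc_surjective (hgen' X)
    -- By compactness of F_m P it is enough to treat morphisms `a` through a single summand, where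
    -- the claim is linearity of φ.
    have key : ∀ m (a : (𝓕.functor m).obj P ⟶ dsum Z),
        hom 𝓕 m (a ≫ ψ) = lin φ (hom 𝓕 m (a ≫ π)) := by
      intro m a
      have ha := hP.map (𝓕.functor m) _ _ _ (jointlyEpi_dsumι Z) a
      induction ha using AddSubgroup.closure_induction with
      | mem a ha =>
        obtain ⟨j, b, rfl⟩ := ha
        rw [Category.assoc, Category.assoc, dsumι_desc, dsumι_desc]
        refine (hom_comp_eq_smul b (c j.1 j.2)).trans ?_
        rw [hc]
        refine ((lin φ).map_smul _ _).symm.trans (congrArg (lin φ) ?_)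
        exact (hom_comp_eq_smul b j.2).symm
      | zero =>
        rw [Limits.zero_comp, Limits.zero_comp, map_zero, map_zero]
        exact (map_zero (lin φ)).symm
      | add a b _ _ ha hb =>
        rw [Preadditive.add_comp, Preadditive.add_comp, map_add, map_add, ha, hb]
        exact ((lin φ).map_add _ _).symm
      | neg a _ ha =>
        rw [Preadditive.neg_comp, Preadditive.neg_comp, map_neg, map_neg, ha]
        exact ((lin φ).map_neg _).symm
    -- The F_n P detect morphisms out of the kernel of π, and `key` turns vanishing after π into
    -- vanishing after ψ.
    have hker : (dsum Z).subι _ (isHomogeneous_ker π) ≫ ψ = 0 := by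
      refine hgen' _ _ _ fun y => hom_injective (𝓕 := 𝓕) y.1 ?_
      rw [← Category.assoc, key, Category.assoc]
      have : (dsum Z).subι _ (isHomogeneous_ker π) ≫ π = 0 := hom_ext fun m => m.2
      rw [this, Limits.comp_zero, Limits.comp_zero, map_zero, map_zero]
      exact map_zero (lin φ)
    obtain ⟨f, hf⟩ := exists_lift_of_surjective π ψ hπ fun a ha =>
      congrArg (fun t => lin t (⟨a, ha⟩ : LinearMap.ker (lin π))) hker
    refine ⟨f, hom_ext_of_homogeneous ?_⟩
    rintro n _ ⟨x, rfl⟩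
    rw [lin_homFunctor_map, hom_comp_inc, ← hc]
    congr 1
    have h1 : dsumι Z ⟨n, x⟩ ≫ π = x := dsumι_desc _ _
    have h2 : dsumι Z ⟨n, x⟩ ≫ ψ = c n x := dsumι_desc _ _
    rw [← h2, ← hf, reassoc_of% h1]

/-- The morphism to `M` from the module of `F_n P` given by a homogeneous element of degree `n`. -/
noncomputable def ofElement (M : GrMod (TwistedEnd.deg 𝓕 P)) {n : ℤ} (m : M.deg n) :
    (homFunctor 𝓕 P).obj ((𝓕.functor n).obj P) ⟶ M :=
  ofLin (M := (homFunctor 𝓕 P).obj ((𝓕.functor n).obj P))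
    ((LinearMap.toSpanSingleton (TwistedEnd 𝓕 P)ᵐᵒᵖ M.carrier m.1).comp
      (IsSummand.linearForm (twist 𝓕 P n).inv)) fun i q hq => by
    have h : (toOrb 𝓕 P).symm (q ≫ (twist 𝓕 P n).inv) ∈ TwistedEnd.deg 𝓕 P (-n + i) :=
      comp_mem_deg rfl hq (twist_inv_mem_deg 𝓕 P n)
    have := M.smul_mem _ _ _ _ m.2 h
    rwa [add_neg_cancel_left] at this

theorem lin_ofElement (M : GrMod (TwistedEnd.deg 𝓕 P)) {n : ℤ} (m : M.deg n) :
    lin (ofElement M m) (twist 𝓕 P n).hom = m := by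
  change op ((toOrb 𝓕 P).symm ((twist 𝓕 P n).hom ≫ (twist 𝓕 P n).inv)) • m.1 = m.1
  rw [Iso.hom_inv_id, ← toOrb_one, LinearEquiv.symm_apply_apply, op_one, one_smul]

/-- The comparison of the direct sum of modules with the module of a direct sum. -/
noncomputable def dsumComparison {ι : Type u} (Z : ι → GrMod 𝒜) :
    dsum (fun j => (homFunctor 𝓕 P).obj (Z j)) ⟶ (homFunctor 𝓕 P).obj (dsum Z) :=
  dsumDesc _ fun j => (homFunctor 𝓕 P).map (dsumι Z j)

/-- Injectivity is seen on the projections to the summands. Surjectivity is compactness: a morphism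
from F_n P to a direct sum is a finite sum of morphisms through summands. -/
theorem dsumComparison_bijective (hP : IsCompactProjective P) {ι : Type u} (Z : ι → GrMod 𝒜) :
    Function.Bijective (lin (dsumComparison (𝓕 := 𝓕) (P := P) Z)) := by
  constructor
  · have h : ∀ j, dsumComparison (𝓕 := 𝓕) (P := P) Z ≫ (homFunctor 𝓕 P).map (dsumπ Z j) =
        dsumπ (fun j => (homFunctor 𝓕 P).obj (Z j)) j := by
      intro j
      refine dsum_hom_ext fun j' => ?_
      unfold dsumComparison
      rw [reassoc_of% dsumι_desc]
      refine ((homFunctor 𝓕 P).map_comp _ _).symm.trans ?_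
      obtain rfl | hj := eq_or_ne j' j
      · rw [dsumι_π, dsumι_π]
        exact (homFunctor 𝓕 P).map_id _
      · rw [dsumι_π_ne hj, dsumι_π_ne hj]
        exact (homFunctor 𝓕 P).map_zero _ _
    intro q q' hq
    refine dsum_ext fun j => ?_
    rw [← h j]
    exact congrArg (lin ((homFunctor 𝓕 P).map (dsumπ Z j))) hq
  · rw [← LinearMap.range_eq_top, Submodule.eq_top_iff']
    intro q
    induction q using ((homFunctor 𝓕 P).obj (dsum Z)).induction with
    | h0 => exact zero_mem _
    | add x y hx hy => exact add_mem hx hy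
    | hom n q hq =>
      obtain ⟨a, rfl⟩ := hq
      have ha := hP.map (𝓕.functor n) _ _ _ (jointlyEpi_dsumι Z) a
      induction ha using AddSubgroup.closure_induction with
      | mem a ha =>
        obtain ⟨j, b, rfl⟩ := ha
        let z : ((homFunctor 𝓕 P).obj (Z j)).carrier := hom 𝓕 n b
        refine ⟨lin (dsumι (fun j => (homFunctor 𝓕 P).obj (Z j)) j) z, ?_⟩
        exact (lin_dsumDesc (fun j => (homFunctor 𝓕 P).map (dsumι Z j)) j z).trans
          (hom_comp_inc b (dsumι Z j))
      | zero => rw [map_zero]; exact zero_mem _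
      | add a b _ _ ha hb => rw [map_add]; exact add_mem ha hb
      | neg a _ ha => rw [map_neg]; exact neg_mem ha

/-- Compact projectivity of F_n P, applied to the one-member family `q`, says that each F_n P ⟶ X is
a sum of liftable morphisms, hence liftable. -/
theorem homFunctor_map_surjective (hP : IsCompactProjective P) {A X : GrMod 𝒜} (q : A ⟶ X)
    (hq : Function.Surjective (lin q)) :
    Function.Surjective (lin ((homFunctor 𝓕 P).map q)) := by
  have := epi_of_surjective q hq
  rw [← LinearMap.range_eq_top, Submodule.eq_top_iff']
  intro z
  induction z using ((homFunctor 𝓕 P).obj X).induction with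
  | h0 => exact zero_mem _
  | add x y hx hy => exact add_mem hx hy
  | hom n z hz =>
    obtain ⟨a, rfl⟩ := hz
    have ha := hP.map (𝓕.functor n) (fun _ : PUnit.{u + 1} => A) X (fun _ => q)
      (fun _ _ _ h => (cancel_epi q).1 (h ⟨⟩)) a
    induction ha using AddSubgroup.closure_induction with
    | mem a ha =>
      obtain ⟨j, b, rfl⟩ := ha
      exact ⟨hom 𝓕 n b, hom_comp_inc b q⟩
    | zero => rw [map_zero]; exact zero_mem _
    | add a b _ _ ha hb => rw [map_add]; exact add_mem ha hb
    | neg a _ ha => rw [map_neg]; exact neg_mem ha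

/-- Homogeneous elements of M give a cover of M by a direct sum of modules of the F_n P, which is
the module of `dsum Z`. The homogeneous relations are morphisms F_l P ⟶ `dsum Z`; dividing `dsum Z`
by the sum of their ranges gives an object whose module is isomorphic to M. -/
theorem homFunctor_essSurj (hP : IsCompactProjective P) : (homFunctor 𝓕 P).EssSurj where
  mem_essImage M := by
    let Z : (Σ n, M.deg n) → GrMod 𝒜 := fun j => (𝓕.functor j.1).obj P
    let κ := isoOfBijective _ (dsumComparison_bijective (𝓕 := 𝓕) hP Z)
    let ρ : dsum (fun j => (homFunctor 𝓕 P).obj (Z j)) ⟶ M := dsumDesc _ fun j => ofElement M j.2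
    have hρ : Function.Surjective (lin ρ) := by
      rw [← LinearMap.range_eq_top, Submodule.eq_top_iff']
      intro m
      induction m using M.induction with
      | h0 => exact zero_mem _
      | add x y hx hy => exact add_mem hx hy
      | hom n m hm =>
        let z : ((homFunctor 𝓕 P).obj (Z ⟨n, m, hm⟩)).carrier := (twist 𝓕 P n).hom
        refine ⟨lin (dsumι (fun j => (homFunctor 𝓕 P).obj (Z j)) ⟨n, m, hm⟩) z, ?_⟩
        exact (lin_dsumDesc (fun j : Σ n, M.deg n => ofElement M j.2) ⟨n, m, hm⟩ z).trans
          (lin_ofElement M ⟨m, hm⟩)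
    let σ : (homFunctor 𝓕 P).obj (dsum Z) ⟶ M := κ.inv ≫ ρ
    have hσ : Function.Surjective (lin σ) := by
      intro m
      obtain ⟨u, rfl⟩ := hρ m
      refine ⟨lin κ.hom u, ?_⟩
      exact congrArg (fun f => lin f u) (κ.hom_inv_id_assoc ρ)
    let s : ((of P : Orb 𝓕) ⟶ of (dsum Z)) →ₗ[(TwistedEnd 𝓕 P)ᵐᵒᵖ] M.carrier := lin σ
    let x : ∀ j : Σ l, {a : (𝓕.functor l).obj P ⟶ dsum Z // s (hom 𝓕 l a) = 0},
      (𝓕.functor j.1).obj P ⟶ dsum Z := fun j => j.2.1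
    let q := (dsum Z).quotπ _ (isHomogeneous_iSup_range x)
    have hq := (dsum Z).quotπ_eq_zero_iff _ (isHomogeneous_iSup_range x)
    refine ⟨_, nonempty_iso_of_ker_eq ((homFunctor 𝓕 P).map q) σ
      (homFunctor_map_surjective hP q ((dsum Z).quotπ_surjective _ _)) hσ
      (ker_eq_of_homogeneous _ _ ?_)⟩
    rintro l _ ⟨a, rfl⟩
    rw [lin_homFunctor_map, hom_comp_inc]
    change _ ↔ s (hom 𝓕 l a) = 0
    constructor
    · intro h
      have h0 : a ≫ q = 0 := hom_injective l (h.trans (map_zero _).symm)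
      -- A morphism with range in the sum of the ranges of the relations is, by compactness, a sum
      -- of ring multiples of relations, so dividing by them kills nothing new. Conversely, a
      -- relation is itself a member of the family `x`.
      have ha := mem_factoring_of_mem_iSup_range (hP.map (𝓕.functor l)) x a fun y =>
        (hq _).1 (congrArg (fun f => lin f y) h0)
      clear h h0
      induction ha using AddSubgroup.closure_induction with
      | mem a ha =>
        obtain ⟨j, b, rfl⟩ := ha
        rw [hom_comp_eq_smul b (x j), map_smul, j.2.2, smul_zero]
      | zero => rw [map_zero, map_zero]
      | add a b _ _ ha hb => rw [map_add, map_add, ha, hb, add_zero]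
      | neg a _ ha => rw [map_neg, map_neg, ha, neg_zero]
    · intro h
      have hy : ∀ y, lin a y ∈ ⨆ j, LinearMap.range (lin (x j)) := fun y =>
        Submodule.mem_iSup_of_mem (p := fun j => LinearMap.range (lin (x j))) ⟨l, a, h⟩
          (LinearMap.mem_range_self (lin a) y)
      have : a ≫ q = 0 := hom_ext fun y => (hq (lin a y)).2 (hy y)
      exact (congrArg (hom 𝓕 l) this).trans (map_zero _)

theorem homFunctor_isEquivalence (hP : IsCompactProjective P)
    (hgen : (ObjectProperty.ofObj fun n => (𝓕.functor n).obj P).IsSeparating) :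
    (homFunctor 𝓕 P).IsEquivalence where
  faithful := homFunctor_faithful hgen
  full := homFunctor_full hP hgen
  essSurj := homFunctor_essSurj hP

end Orb

/-! ### Restriction of scalars along an isomorphism of graded algebras -/

namespace GrMod

open MulOpposite

variable {k : Type w} [CommRing k] {T S : Type u} [Ring T] [Ring S] [Algebra k T] [Algebra k S]
  {𝒯 : ℤ → Submodule k T} {𝒮 : ℤ → Submodule k S}

/-- The restriction of scalars of a graded module along an isomorphism of graded algebras. -/
def resObj (e : S ≃ₐ[k] T) (he : ∀ n s, s ∈ 𝒮 n ↔ e s ∈ 𝒯 n) (M : GrMod 𝒯) : GrMod 𝒮 :=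
  letI : Module Sᵐᵒᵖ M.carrier := Module.compHom M.carrier (e : S →+* T).op
  { carrier := M.carrier
    isScalarTower := ⟨fun c s m => by
      change op (e (c • s.unop)) • m = c • (op (e s.unop) • m)
      rw [map_smul, op_smul, smul_assoc]⟩
    deg := M.deg
    isInternal := M.isInternal
    smul_mem := fun i j m s hm hs => M.smul_mem i j m (e s) hm ((he j s).1 hs) }

/-- The restriction of scalars along an isomorphism of graded algebras. -/
def res (e : S ≃ₐ[k] T) (he : ∀ n s, s ∈ 𝒮 n ↔ e s ∈ 𝒯 n) : GrMod 𝒯 ⥤ GrMod 𝒮 where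
  obj := resObj e he
  map {M N} f := ofLin (M := resObj e he M) (N := resObj e he N)
    { toFun := lin f
      map_add' := (lin f).map_add
      map_smul' := fun s m => (lin f).map_smul (op (e s.unop)) m } f.2

variable (e : S ≃ₐ[k] T) (he : ∀ n s, s ∈ 𝒮 n ↔ e s ∈ 𝒯 n)

instance : (res e he).Additive where
  map_add := rfl

instance : (res e he).Linear k where

instance : (res e he).Faithful where
  map_injective {M N _ _} h := hom_ext fun m =>
    congrArg (fun t : resObj e he M ⟶ resObj e he N => lin t m) h

instance : (res e he).Full where
  map_surjective {M N} f := by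
    let φ : M.carrier → N.carrier := f.1
    refine ⟨ofLin
      { toFun := φ
        map_add' := f.1.map_add
        map_smul' := fun t m => ?_ } f.2, rfl⟩
    have h : φ (op (e (e.symm t.unop)) • m) = op (e (e.symm t.unop)) • φ m :=
      f.1.map_smul (op (e.symm t.unop)) m
    rwa [e.apply_symm_apply] at h

instance : (res e he).EssSurj where
  mem_essImage M := by
    have he' : ∀ n t, t ∈ 𝒯 n ↔ e.symm t ∈ 𝒮 n := fun n t => by
      rw [he, e.apply_symm_apply]
    refine ⟨resObj e.symm he' M, ⟨isoOfBijective (M := resObj e he (resObj e.symm he' M))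
      (ofLin (M := resObj e he (resObj e.symm he' M))
        { toFun := fun m => m
          map_add' := fun _ _ => rfl
          map_smul' := fun s m => ?_ } fun _ _ hm => hm) Function.bijective_id⟩⟩
    exact congrArg (fun s' : S => op s' • (show M.carrier from m)) (e.symm_apply_apply s.unop)

instance : (res e he).IsEquivalence where

/-- Restriction of scalars commutes with the shift. -/
def resShift : shift 𝒯 ⋙ res e he ≅ res e he ⋙ shift 𝒮 := Iso.refl _

end GrMod

/-! ### Comparison of `ℤ`-sequences -/

namespace ZSequence

variable {k : Type w} [CommRing k] {C : Type u} [Category.{v} C] [Preadditive C] [Linear k C]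
  {F F' : Autoequivalence k C}

/-- Associativity for (1, n, j), rearranged to say that the η^{n,j} with j fixed are compatible with
raising n by one. In this form it feeds `ZChain.Compat`. -/
theorem η_step (𝓕 : ZSequence F) {n m j nj mj : ℤ} (h : 1 + n = m) (hn : n + j = nj)
    (hm : m + j = mj) (h' : 1 + nj = mj) (X : C) :
    (𝓕.functor 1).map ((𝓕.η n j nj hn).hom.app X) ≫
        (𝓕.η 1 n m h).inv.app ((𝓕.functor j).obj X) =
      (𝓕.η 1 nj mj h').inv.app X ≫ (𝓕.η m j mj hm).hom.app X := by
  have := 𝓕.η_assoc 1 n j m nj mj h hn h' hm X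
  rw [← cancel_epi ((𝓕.η 1 nj mj h').hom.app X), reassoc_of% this]
  simp

section

variable (𝓕 : ZSequence F) (𝓕' : ZSequence F') {G : C ⥤ C}
  (α : 𝓕.functor 1 ⋙ G ≅ G ⋙ 𝓕'.functor 1)

/-- Composition with the first term of a sequence. -/
abbrev postcompOne : (C ⥤ C) ⥤ (C ⥤ C) :=
  (Functor.whiskeringRight C C C).obj (𝓕.functor 1)

/-- Composition with the first term of a sequence is fully faithful. -/
noncomputable def postcompOneFullyFaithful : 𝓕.postcompOne.FullyFaithful :=
  (Functor.FullyFaithful.ofFullyFaithful (𝓕.functor 1)).whiskeringRight C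

instance : 𝓕.postcompOne.Faithful := 𝓕.postcompOneFullyFaithful.faithful

/-- The chain `n ↦ G ∘ F_{d n}`. -/
def leftChain (d : ℤ → ℤ) (hd : ∀ n m, n + 1 = m → 1 + d n = d m) : ZChain 𝓕'.postcompOne where
  obj n := 𝓕.functor (d n) ⋙ G
  step n m h := NatIso.ofComponents
    (fun X => α.symm.app ((𝓕.functor (d n)).obj X) ≪≫
      G.mapIso ((𝓕.η 1 (d n) (d m) (hd n m h)).symm.app X))
    fun {X Y} f => by
      have e1 := α.inv.naturality ((𝓕.functor (d n)).map f)
      have e2 := congrArg G.map ((𝓕.η 1 (d n) (d m) (hd n m h)).inv.naturality f)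
      simp only [Functor.comp_map, Functor.comp_obj, Functor.map_comp] at e1 e2
      change (𝓕'.functor 1).map (G.map ((𝓕.functor (d n)).map f)) ≫ α.inv.app _ ≫
          G.map ((𝓕.η 1 (d n) (d m) (hd n m h)).inv.app Y) =
        (α.inv.app _ ≫ G.map ((𝓕.η 1 (d n) (d m) (hd n m h)).inv.app X)) ≫
          G.map ((𝓕.functor (d m)).map f)
      rw [reassoc_of% e1, e2, Category.assoc]

/-- The chain `n ↦ F_n ∘ K`. -/
def rightChain (K : C ⥤ C) : ZChain 𝓕'.postcompOne where
  obj n := K ⋙ 𝓕'.functor n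
  step n m h := NatIso.ofComponents
    (fun X => (𝓕'.η 1 n m (by rw [← h, add_comm])).symm.app (K.obj X))
    fun {X Y} f => (𝓕'.η 1 n m (by rw [← h, add_comm])).inv.naturality (K.map f)

/-- The isomorphisms `G ∘ F_n ≅ F'_n ∘ G` induced by one for `n = 1`. -/
noncomputable def conjIso (n : ℤ) : 𝓕.functor n ⋙ G ≅ G ⋙ 𝓕'.functor n :=
  ZChain.iso 𝓕'.postcompOneFullyFaithful
    (leftChain 𝓕 𝓕' α (fun n => n) fun n m h => by rw [← h, add_comm]) (rightChain 𝓕' G)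
    (Functor.isoWhiskerRight 𝓕.zero G ≪≫ Functor.isoWhiskerLeft G 𝓕'.zero.symm) n

theorem conjIso_zero (X : C) :
    (conjIso 𝓕 𝓕' α 0).hom.app X = G.map (𝓕.zero.hom.app X) ≫ 𝓕'.zero.inv.app (G.obj X) := rfl

theorem conjIso_step {n m : ℤ} (h : 1 + n = m) (X : C) :
    (𝓕'.functor 1).map ((conjIso 𝓕 𝓕' α n).hom.app X) ≫ (𝓕'.η 1 n m h).inv.app (G.obj X) =
      α.inv.app ((𝓕.functor n).obj X) ≫ G.map ((𝓕.η 1 n m h).inv.app X) ≫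
        (conjIso 𝓕 𝓕' α m).hom.app X := by
  have := congrArg (fun t => t.app X) (ZChain.iso_compat 𝓕'.postcompOneFullyFaithful
    (leftChain 𝓕 𝓕' α (fun n => n) fun n m h => by rw [← h, add_comm]) (rightChain 𝓕' G)
    (Functor.isoWhiskerRight 𝓕.zero G ≪≫ Functor.isoWhiskerLeft G 𝓕'.zero.symm)
    n m (by rw [← h, add_comm]))
  exact this.trans (Category.assoc _ _ _)

/-- With j fixed, both sides are families in i from the chain G F_{i+j} to the chain F'_i F'_j G
that are compatible with the steps. Such families are determined by their value at i = 0
(`ZChain.Compat.ext`), where the unit axioms apply. -/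
theorem conjIso_add (i j : ℤ) (X : C) :
    (conjIso 𝓕 𝓕' α (i + j)).hom.app X ≫ (𝓕'.η i j (i + j) rfl).hom.app (G.obj X) =
      G.map ((𝓕.η i j (i + j) rfl).hom.app X) ≫
        (conjIso 𝓕 𝓕' α i).hom.app ((𝓕.functor j).obj X) ≫
          (𝓕'.functor i).map ((conjIso 𝓕 𝓕' α j).hom.app X) := by
  have key := ZChain.Compat.ext
    (A := leftChain 𝓕 𝓕' α (fun n => n + j) fun n m h => by rw [← h]; ring)
    (B := rightChain 𝓕' (G ⋙ 𝓕'.functor j))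
    (f := fun i => (conjIso 𝓕 𝓕' α (i + j)).hom ≫
      Functor.whiskerLeft G (𝓕'.η i j (i + j) rfl).hom)
    (g := fun i => Functor.whiskerRight (𝓕.η i j (i + j) rfl).hom G ≫
      Functor.whiskerLeft (𝓕.functor j) (conjIso 𝓕 𝓕' α i).hom ≫
        Functor.whiskerRight (conjIso 𝓕 𝓕' α j).hom (𝓕'.functor i)) ?_ ?_ ?_ i
  · exact congrArg (fun t => t.app X) key
  · intro n m h
    have h1 : 1 + n = m := by rw [← h, add_comm]
    have h2 : 1 + (n + j) = m + j := by rw [← h]; ring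
    refine NatTrans.ext (funext fun X => ?_)
    have e1 := 𝓕'.η_step h1 rfl rfl h2 (G.obj X)
    have e2 := conjIso_step 𝓕 𝓕' α h2 X
    change (𝓕'.functor 1).map ((conjIso 𝓕 𝓕' α (n + j)).hom.app X ≫
        (𝓕'.η n j (n + j) rfl).hom.app (G.obj X)) ≫
          (𝓕'.η 1 n m h1).inv.app ((𝓕'.functor j).obj (G.obj X)) =
      (α.inv.app ((𝓕.functor (n + j)).obj X) ≫ G.map ((𝓕.η 1 (n + j) (m + j) h2).inv.app X)) ≫
        (conjIso 𝓕 𝓕' α (m + j)).hom.app X ≫ (𝓕'.η m j (m + j) rfl).hom.app (G.obj X)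
    rw [Functor.map_comp, Category.assoc, e1, reassoc_of% e2, Category.assoc]
  · intro n m h
    have h1 : 1 + n = m := by rw [← h, add_comm]
    have h2 : 1 + (n + j) = m + j := by rw [← h]; ring
    refine NatTrans.ext (funext fun X => ?_)
    have e1 := 𝓕.η_step h1 rfl rfl h2 X
    have e2 := conjIso_step 𝓕 𝓕' α h1 ((𝓕.functor j).obj X)
    have e3 := (𝓕'.η 1 n m h1).inv.naturality ((conjIso 𝓕 𝓕' α j).hom.app X)
    have e4 := α.inv.naturality ((𝓕.η n j (n + j) rfl).hom.app X)
    simp only [Functor.comp_map, Functor.comp_obj] at e3 e4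
    change (𝓕'.functor 1).map (G.map ((𝓕.η n j (n + j) rfl).hom.app X) ≫
        (conjIso 𝓕 𝓕' α n).hom.app ((𝓕.functor j).obj X) ≫
          (𝓕'.functor n).map ((conjIso 𝓕 𝓕' α j).hom.app X)) ≫
          (𝓕'.η 1 n m h1).inv.app ((𝓕'.functor j).obj (G.obj X)) =
      (α.inv.app ((𝓕.functor (n + j)).obj X) ≫ G.map ((𝓕.η 1 (n + j) (m + j) h2).inv.app X)) ≫
        G.map ((𝓕.η m j (m + j) rfl).hom.app X) ≫
        (conjIso 𝓕 𝓕' α m).hom.app ((𝓕.functor j).obj X) ≫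
          (𝓕'.functor m).map ((conjIso 𝓕 𝓕' α j).hom.app X)
    simp only [Functor.map_comp, Category.assoc]
    rw [e3, reassoc_of% e2, reassoc_of% e4, ← G.map_comp_assoc, e1, G.map_comp_assoc]
  · refine NatTrans.ext (funext fun X => ?_)
    -- The index 0 + j is generalized so that it can be replaced by j without transport.
    suffices h : ∀ j' (hj : 0 + j = j'), (conjIso 𝓕 𝓕' α j').hom.app X ≫
        (𝓕'.η 0 j j' hj).hom.app (G.obj X) = G.map ((𝓕.η 0 j j' hj).hom.app X) ≫
          (conjIso 𝓕 𝓕' α 0).hom.app ((𝓕.functor j).obj X) ≫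
            (𝓕'.functor 0).map ((conjIso 𝓕 𝓕' α j).hom.app X) from h _ rfl
    intro j' hj
    obtain rfl : j' = j := hj.symm.trans (zero_add j)
    have e1 := congrArg G.map (𝓕.η_zero_left j' X)
    have e2 := 𝓕'.η_zero_left j' (G.obj X)
    have e3 := 𝓕'.zero.inv.naturality ((conjIso 𝓕 𝓕' α j').hom.app X)
    have e4 : 𝓕'.zero.inv.app ((𝓕'.functor j').obj (G.obj X)) =
        (𝓕'.η 0 j' j' hj).hom.app (G.obj X) :=
      (cancel_mono (𝓕'.zero.hom.app ((𝓕'.functor j').obj (G.obj X)))).1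
        ((𝓕'.zero.inv_hom_id_app _).trans e2.symm)
    rw [G.map_comp, G.map_id] at e1
    simp only [Functor.comp_obj, Functor.id_obj, Functor.id_map] at e3
    rw [conjIso_zero, Category.assoc, reassoc_of% e1, ← e3]
    exact congrArg _ e4.symm

end

/-! ### The twisted endomorphism rings of conjugate sequences -/

section

open TwistedEnd

variable (𝓕 : ZSequence F) (𝓕' : ZSequence F') {G : C ⥤ C} [G.IsEquivalence] [G.Additive]
  [G.Linear k] (α : 𝓕.functor 1 ⋙ G ≅ G ⋙ 𝓕'.functor 1) {X Y : C} (e : Y ≅ G.obj X)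

/-- The bijection `hom(F_n X, X) ≅ hom(F'_n Y, Y)` for an isomorphism `Y ≅ G X`. -/
noncomputable def conjPiece (n : ℤ) :
    ((𝓕.functor n).obj X ⟶ X) ≃ₗ[k] ((𝓕'.functor n).obj Y ⟶ Y) :=
  LinearEquiv.ofBijective
    { toFun := fun a => (𝓕'.functor n).map e.hom ≫ (conjIso 𝓕 𝓕' α n).inv.app X ≫ G.map a ≫ e.inv
      map_add' := fun a b => by
        simp only [Functor.map_add, Preadditive.add_comp, Preadditive.comp_add]
      map_smul' := fun c a => by
        simp only [Functor.map_smul, Linear.smul_comp, Linear.comp_smul, RingHom.id_apply] }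
    ⟨fun a b h => by
      refine G.map_injective ?_
      simpa only [LinearMap.coe_mk, AddHom.coe_mk, cancel_epi, cancel_mono] using h,
    fun b => ⟨G.preimage ((conjIso 𝓕 𝓕' α n).hom.app X ≫ (𝓕'.functor n).map e.inv ≫ b ≫ e.hom), by
      simp [← Functor.map_comp_assoc]⟩⟩

theorem conjPiece_apply (n : ℤ) (a : (𝓕.functor n).obj X ⟶ X) :
    conjPiece 𝓕 𝓕' α e n a =
      (𝓕'.functor n).map e.hom ≫ (conjIso 𝓕 𝓕' α n).inv.app X ≫ G.map a ≫ e.inv := rfl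

theorem conjPiece_mulAt {i j : ℤ} (a : (𝓕.functor i).obj X ⟶ X) (b : (𝓕.functor j).obj X ⟶ X) :
    conjPiece 𝓕 𝓕' α e (i + j) (TwistedEndPiece.mulAt 𝓕 X (i + j) rfl a b) =
      TwistedEndPiece.mulAt 𝓕' Y (i + j) rfl (conjPiece 𝓕 𝓕' α e i a)
        (conjPiece 𝓕 𝓕' α e j b) := by
  have h1 := conjIso_add 𝓕 𝓕' α i j X
  have h2 := (𝓕'.η i j (i + j) rfl).hom.naturality e.hom
  have h3 := (conjIso 𝓕 𝓕' α i).inv.naturality b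
  -- This is `conjIso_add` solved for the inverses, the direction used by `conjPiece`.
  have h4 : (conjIso 𝓕 𝓕' α (i + j)).inv.app X ≫ G.map ((𝓕.η i j (i + j) rfl).hom.app X) =
      (𝓕'.η i j (i + j) rfl).hom.app (G.obj X) ≫
        (𝓕'.functor i).map ((conjIso 𝓕 𝓕' α j).inv.app X) ≫
          (conjIso 𝓕 𝓕' α i).inv.app ((𝓕.functor j).obj X) := by
    rw [← cancel_epi ((conjIso 𝓕 𝓕' α (i + j)).hom.app X), Iso.hom_inv_id_app_assoc,
      reassoc_of% h1, ← Functor.map_comp_assoc, Iso.hom_inv_id_app]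
    simp
  simp only [Functor.comp_map, Functor.comp_obj] at h2 h3 h4
  simp only [conjPiece_apply, TwistedEndPiece.mulAt, Functor.map_comp, Category.assoc]
  rw [reassoc_of% h4, reassoc_of% h2, ← (𝓕'.functor i).map_comp_assoc e.inv e.hom,
    Iso.inv_hom_id, (𝓕'.functor i).map_id, Category.id_comp, reassoc_of% h3]

/-- The comparison of twisted endomorphism rings as a linear map. -/
noncomputable def conjLinear : TwistedEnd 𝓕 X ≃ₗ[k] TwistedEnd 𝓕' Y :=
  DFinsupp.mapRange.linearEquiv fun n => conjPiece 𝓕 𝓕' α e n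

theorem conjLinear_single (n : ℤ) (a : (𝓕.functor n).obj X ⟶ X) :
    conjLinear 𝓕 𝓕' α e (single n a) = single n (conjPiece 𝓕 𝓕' α e n a) :=
  DFinsupp.mapRange_single (f := fun n a => conjPiece 𝓕 𝓕' α e n a)
    (hf := fun n => map_zero (conjPiece 𝓕 𝓕' α e n))

theorem one_eq_single : (1 : TwistedEnd 𝓕 X) = single 0 (𝓕.zero.hom.app X) := rfl

/-- The comparison of twisted endomorphism rings. -/
noncomputable def conjEquiv : TwistedEnd 𝓕 X ≃ₐ[k] TwistedEnd 𝓕' Y :=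
  AlgEquiv.ofLinearEquiv (conjLinear 𝓕 𝓕' α e)
    (by
      rw [one_eq_single, one_eq_single, conjLinear_single]
      congr 1
      have h1 : (conjIso 𝓕 𝓕' α 0).inv.app X ≫ G.map (𝓕.zero.hom.app X) =
          𝓕'.zero.hom.app (G.obj X) := by
        rw [← cancel_epi ((conjIso 𝓕 𝓕' α 0).hom.app X), Iso.hom_inv_id_app_assoc, conjIso_zero,
          Category.assoc]
        exact ((congrArg _ (𝓕'.zero.inv_hom_id_app (G.obj X))).trans (Category.comp_id _)).symm
      have h2 := 𝓕'.zero.hom.naturality e.hom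
      simp only [Functor.comp_obj, Functor.id_obj, Functor.id_map] at h1 h2
      refine (conjPiece_apply 𝓕 𝓕' α e 0 _).trans ?_
      rw [reassoc_of% h1, reassoc_of% h2, Iso.hom_inv_id, Category.comp_id])
    (fun t u => by
      induction t using TwistedEnd.induction with
      | zero => rw [zero_mul, map_zero, zero_mul]
      | add x y hx hy => rw [add_mul, map_add, map_add, add_mul, hx, hy]
      | single i a =>
        induction u using TwistedEnd.induction with
        | zero => rw [mul_zero, map_zero, mul_zero]
        | add x y hx hy => rw [mul_add, map_add, map_add, mul_add, hx, hy]
        | single j b =>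
          rw [single_mul_single, conjLinear_single, conjLinear_single, conjLinear_single,
            single_mul_single, conjPiece_mulAt])

theorem conjEquiv_mem (n : ℤ) (t : TwistedEnd 𝓕 X) :
    t ∈ TwistedEnd.deg 𝓕 X n ↔ conjEquiv 𝓕 𝓕' α e t ∈ TwistedEnd.deg 𝓕' Y n := by
  constructor
  · rintro ⟨a, rfl⟩
    exact ⟨conjPiece 𝓕 𝓕' α e n a, (conjLinear_single 𝓕 𝓕' α e n a).symm⟩
  · rintro ⟨(b : (𝓕'.functor n).obj Y ⟶ Y), hb⟩
    refine ⟨(conjPiece 𝓕 𝓕' α e n).symm b, (conjEquiv 𝓕 𝓕' α e).injective ?_⟩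
    refine (conjLinear_single 𝓕 𝓕' α e n _).trans ?_
    rw [LinearEquiv.apply_symm_apply]
    exact hb

end

end ZSequence

/-! ### Conjugate autoequivalences and graded Morita equivalence -/

section Separating

variable {C : Type*} [Category* C] {D : Type*} [Category* D] {ι : Type*}

theorem isSeparating_of_iso {Z Z' : ι → C} (e : ∀ i, Z i ≅ Z' i)
    (h : (ObjectProperty.ofObj Z).IsSeparating) : (ObjectProperty.ofObj Z').IsSeparating := by
  intro X Y f g hfg
  refine h f g ?_
  rintro _ ⟨i⟩ a
  have := hfg (Z' i) ⟨i⟩ ((e i).inv ≫ a)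
  rwa [Category.assoc, Category.assoc, cancel_epi] at this

theorem isSeparating_of_map (E : C ⥤ D) [E.Full] [E.Faithful] {Z : ι → C}
    (h : (ObjectProperty.ofObj fun i => E.obj (Z i)).IsSeparating) :
    (ObjectProperty.ofObj Z).IsSeparating := by
  intro X Y f g hfg
  refine E.map_injective (h _ _ ?_)
  rintro _ ⟨i⟩ a
  have := congrArg E.map (hfg (Z i) ⟨i⟩ (E.preimage a))
  simpa using this

end Separating

namespace ZSequence

variable {k : Type w} [CommRing k] {C : Type u} [Category.{v} C] [Preadditive C] [Linear k C]
  {F : Autoequivalence k C}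

/-- Generativity refers to the powers of F. Taking G to be the identity, `conjIso` identifies them
termwise with any other sequence that has the same first term up to isomorphism. -/
theorem isSeparating_of_isGenerative (𝓕 : ZSequence F) {P : C} (h : F.IsGenerative P) :
    (ObjectProperty.ofObj fun n => (𝓕.functor n).obj P).IsSeparating := by
  let α : F.powers.functor 1 ⋙ 𝟭 C ≅ 𝟭 C ⋙ 𝓕.functor 1 :=
    Functor.rightUnitor _ ≪≫ F.powers.one.some ≪≫ 𝓕.one.some.symm ≪≫ (Functor.leftUnitor _).symm
  exact isSeparating_of_iso (fun n => (conjIso F.powers 𝓕 α n).app P) h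

end ZSequence

namespace Orb

open MulOpposite GrMod

variable {k : Type w} [CommRing k] {C : Type u} [Category.{v} C] [Preadditive C] [Linear k C]
  {F : Autoequivalence k C} {𝓕 : ZSequence F} {P X : C}

/-- All morphisms F_n P ⟶ X together are jointly epimorphic, so compact projectivity of X decomposes
its identity. -/
theorem isSummand_of_isCompactProjective (hX : IsCompactProjective X)
    (hgen : (ObjectProperty.ofObj fun n => (𝓕.functor n).obj P).IsSeparating) :
    IsSummand 𝓕 P X := by
  refine IsSummand.of_factoring ?_
  have h : JointlyEpi (fun j : ULift.{v} (Σ n, ((𝓕.functor n).obj P ⟶ X)) => j.down.2) :=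
    fun B f g hfg => (isSeparating_iff_jointlyEpi _).1 hgen X f g fun j => hfg ⟨j⟩
  refine AddSubgroup.closure_mono ?_ (hX _ _ _ h (𝟙 X))
  rintro _ ⟨j, b, rfl⟩
  exact ⟨j.down, b, rfl⟩

/-- If the module of `X` is isomorphic to a separator, then the objects `F_n X` are separating. -/
theorem isSeparating_of_isSeparator (hX : IsSummand 𝓕 P X)
    (hgen : (ObjectProperty.ofObj fun n => (𝓕.functor n).obj P).IsSeparating)
    {Q : GrMod (TwistedEnd.deg 𝓕 P)} (i : (homFunctor 𝓕 P).obj X ≅ Q)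
    (hQ : IsSeparator (ModuleCat.of.{v} (TwistedEnd 𝓕 P)ᵐᵒᵖ Q.carrier)) :
    (ObjectProperty.ofObj fun n => (𝓕.functor n).obj X).IsSeparating := by
  intro Y Z f g hfg
  have := homFunctor_faithful hgen
  refine (homFunctor 𝓕 P).map_injective (hom_ext fun q => ?_)
  have key : ModuleCat.ofHom (lin ((homFunctor 𝓕 P).map f)) =
      ModuleCat.ofHom (lin ((homFunctor 𝓕 P).map g)) := by
    refine (isSeparator_def _).1 hQ _ _ fun h => ModuleCat.hom_ext (LinearMap.ext fun x => ?_)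
    let φ : ((of P : Orb 𝓕) ⟶ of X) →ₗ[(TwistedEnd 𝓕 P)ᵐᵒᵖ] ((of P : Orb 𝓕) ⟶ of Y) :=
      h.hom.comp (lin i.hom)
    -- The separator is tested on linear maps that need not preserve degree. Each is composition
    -- with some `c` in the orbit category, and the components of `c` are morphisms F_n X ⟶ Y, on
    -- which `f` and `g` agree.
    obtain ⟨c, hc⟩ := hX.postcomp_surjective φ
    have hcfg : c ≫ inc 𝓕 f = c ≫ inc 𝓕 g := ext_coeff fun n => by
      rw [coeff_comp_inc, coeff_comp_inc]
      exact hfg _ ⟨n⟩ (coeff 𝓕 n c)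
    let y : (of P : Orb 𝓕) ⟶ of X := lin i.inv x
    have hx : h.hom x = y ≫ c := by
      have h1 : y ≫ c = h.hom (lin i.hom (lin i.inv x)) := LinearMap.congr_fun hc y
      have h2 : lin i.hom (lin i.inv x) = x := congrArg (fun f => lin f x) i.inv_hom_id
      rw [h1, h2]
    change lin ((homFunctor 𝓕 P).map f) (h.hom x) = lin ((homFunctor 𝓕 P).map g) (h.hom x)
    rw [hx]
    change (y ≫ c) ≫ inc 𝓕 f = (y ≫ c) ≫ inc 𝓕 g
    rw [Category.assoc, hcfg, Category.assoc]
  exact LinearMap.congr_fun (congrArg ModuleCat.Hom.hom key) q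

end Orb

namespace GrMod

variable {k : Type w} [CommRing k] {T : Type u} [Ring T] [Algebra k T] {𝒯 : ℤ → Submodule k T}

/-- The linear equivalence underlying an isomorphism. -/
def linEquiv {M N : GrMod 𝒯} (i : M ≅ N) : M.carrier ≃ₗ[Tᵐᵒᵖ] N.carrier :=
  LinearEquiv.ofLinearMap (lin i.hom) (lin i.inv)
    (LinearMap.ext fun m => congrArg (fun f => lin f m) i.inv_hom_id)
    (LinearMap.ext fun m => congrArg (fun f => lin f m) i.hom_inv_id)

theorem conj_mem_homDeg {M N : GrMod 𝒯} (i : M ≅ N) (n : ℤ) (f : Module.End Tᵐᵒᵖ M.carrier)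
    (hf : f ∈ homDeg M M n) : (linEquiv i).conjAlgEquiv k f ∈ homDeg N N n := by
  intro l m hm
  exact lin_mem i.hom (hf l _ (lin_mem i.inv hm))

theorem conj_mem_homDeg_iff {M N : GrMod 𝒯} (i : M ≅ N) (n : ℤ) (f : Module.End Tᵐᵒᵖ M.carrier) :
    f ∈ homDeg M M n ↔ (linEquiv i).conjAlgEquiv k f ∈ homDeg N N n := by
  refine ⟨conj_mem_homDeg i n f, fun h => ?_⟩
  have h' := conj_mem_homDeg i.symm n _ h
  have : (linEquiv i.symm).conjAlgEquiv k ((linEquiv i).conjAlgEquiv k f) = f :=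
    ((linEquiv i).conjAlgEquiv k).symm_apply_apply f
  rwa [this] at h'

end GrMod

/-! ### The two implications -/

section Conjugate

open GrMod Orb ZSequence

variable {k : Type w} [CommRing k] {R : Type u} [Ring R] [Algebra k R] {𝒜 : ℤ → Submodule k R}
  {P P' : GrMod 𝒜} {F F' : Autoequivalence k (GrMod 𝒜)}

theorem Pic.isConj_mk_iff {C : Type u} [Category.{v} C] [Preadditive C] [Linear k C]
    (F F' : Autoequivalence k C) : IsConj (Pic.mk F) (Pic.mk F') ↔
      ∃ G : Autoequivalence k C, Nonempty (F.functor ⋙ G.functor ≅ G.functor ⋙ F'.functor) := by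
  rw [isConj_iff]
  constructor
  · rintro ⟨c, h⟩
    obtain ⟨G, rfl⟩ : ∃ G, Pic.mk G = c := Quotient.exists_rep c
    rw [mul_inv_eq_iff_eq_mul] at h
    exact ⟨G, Quotient.exact h⟩
  · rintro ⟨G, h⟩
    refine ⟨Pic.mk G, ?_⟩
    rw [mul_inv_eq_iff_eq_mul]
    exact Quotient.sound h

/-- The progenerator is the module of X, where G X ≅ P'. That X is a summand for P gives finite
generation, projectivity and the endomorphism ring; that P is one for X gives the generator
property. -/
theorem isGradedMoritaEquivalent_of_conj (hP : IsCompactProjective P)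
    (hP' : IsCompactProjective P') (𝓕 : ZSequence F) (𝓕' : ZSequence F')
    (hgen : (ObjectProperty.ofObj fun n => (𝓕.functor n).obj P).IsSeparating)
    (hgen' : (ObjectProperty.ofObj fun n => (𝓕'.functor n).obj P').IsSeparating)
    (G : Autoequivalence k (GrMod 𝒜)) (β : F.functor ⋙ G.functor ≅ G.functor ⋙ F'.functor) :
    IsGradedMoritaEquivalent (TwistedEnd.deg 𝓕 P) (TwistedEnd.deg 𝓕' P') := by
  let α : 𝓕.functor 1 ⋙ G.functor ≅ G.functor ⋙ 𝓕'.functor 1 :=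
    Functor.isoWhiskerRight 𝓕.one.some _ ≪≫ β ≪≫ Functor.isoWhiskerLeft _ 𝓕'.one.some.symm
  let X := G.functor.objPreimage P'
  let e : P' ≅ G.functor.obj X := (G.functor.objObjPreimageIso P').symm
  have hX : IsCompactProjective X := (hP'.of_iso e).of_map
  have hgenX : (ObjectProperty.ofObj fun n => (𝓕.functor n).obj X).IsSeparating := by
    refine isSeparating_of_map G.functor (isSeparating_of_iso (fun n => ?_) hgen')
    exact (𝓕'.functor n).mapIso e ≪≫ ((conjIso 𝓕 𝓕' α n).app X).symm
  have hs : IsSummand 𝓕 P X := isSummand_of_isCompactProjective hX hgen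
  have hs' : IsSummand 𝓕 X P := isSummand_of_isCompactProjective hP hgenX
  refine ⟨homModule 𝓕 P X, hs.finite, hs.projective, hs'.isSeparator,
    (conjEquiv 𝓕 𝓕' α e).symm.trans hs.endEquiv, fun n t => ?_⟩
  rw [AlgEquiv.trans_apply, ← hs.endEquiv_mem, conjEquiv_mem 𝓕 𝓕' α e,
    AlgEquiv.apply_symm_apply]

/-- Both module functors are equivalences that turn the first terms of the sequences into the
inverse shift, and restriction of scalars commutes with the shift. So going over by one functor and
back by the other conjugates F into F'. -/
theorem exists_conj_of_algEquiv {X : GrMod 𝒜} (hX : IsCompactProjective X)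
    (hP' : IsCompactProjective P') (𝓕 : ZSequence F) (𝓕' : ZSequence F')
    (hgen : (ObjectProperty.ofObj fun n => (𝓕.functor n).obj X).IsSeparating)
    (hgen' : (ObjectProperty.ofObj fun n => (𝓕'.functor n).obj P').IsSeparating)
    (e : TwistedEnd 𝓕' P' ≃ₐ[k] TwistedEnd 𝓕 X)
    (he : ∀ n s, s ∈ TwistedEnd.deg 𝓕' P' n ↔ e s ∈ TwistedEnd.deg 𝓕 X n) :
    ∃ G : Autoequivalence k (GrMod 𝒜),
      Nonempty (F.functor ⋙ G.functor ≅ G.functor ⋙ F'.functor) := by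
  let A := homFunctor 𝓕 X
  let A' := homFunctor 𝓕' P'
  have : A.IsEquivalence := homFunctor_isEquivalence hX hgen
  have : A'.IsEquivalence := homFunctor_isEquivalence hP' hgen'
  have : A'.asEquivalence.functor.Additive := inferInstanceAs (homFunctor 𝓕' P').Additive
  have : A'.asEquivalence.functor.Linear k := inferInstanceAs ((homFunctor 𝓕' P').Linear k)
  have : A'.inv.Additive := A'.asEquivalence.inverse_additive
  have : A'.inv.Linear k := A'.asEquivalence.inverseLinear k
  let B := A ⋙ res e he
  let G : GrMod 𝒜 ⥤ GrMod 𝒜 := B ⋙ A'.inv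
  let γ : G ⋙ A' ≅ B := Functor.associator _ _ _ ≪≫
    Functor.isoWhiskerLeft B A'.asEquivalence.counitIso ≪≫ Functor.rightUnitor B
  let σ : A ≅ 𝓕.functor 1 ⋙ A ⋙ shift _ := homFunctorShift 𝓕 X
  let σ' : A' ≅ 𝓕'.functor 1 ⋙ A' ⋙ shift _ := homFunctorShift 𝓕' P'
  -- After `A'` and the shift, both sides become `B`; the fully faithful functor `A' ⋙ shift` is
  -- then cancelled.
  let δ : (𝓕.functor 1 ⋙ G) ⋙ (A' ⋙ shift _) ≅ (G ⋙ 𝓕'.functor 1) ⋙ (A' ⋙ shift _) :=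
    Functor.isoWhiskerLeft (𝓕.functor 1) (Functor.isoWhiskerRight γ (shift _)) ≪≫
      Functor.isoWhiskerLeft (𝓕.functor 1 ⋙ A) (resShift e he).symm ≪≫
        Functor.isoWhiskerRight σ.symm (res e he) ≪≫ γ.symm ≪≫ Functor.isoWhiskerLeft G σ'
  let α : 𝓕.functor 1 ⋙ G ≅ G ⋙ 𝓕'.functor 1 := Functor.fullyFaithfulCancelRight _ δ
  exact ⟨⟨G⟩, ⟨Functor.isoWhiskerRight 𝓕.one.some.symm G ≪≫ α ≪≫
    Functor.isoWhiskerLeft G 𝓕'.one.some⟩⟩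

/-- Pulling Q back along the module functor of P gives an X that inherits compact projectivity and
generation from Q and has End Q as its twisted endomorphism ring. This replaces P by X and reduces
to isomorphic graded rings. -/
theorem exists_conj_of_isGradedMoritaEquivalent (hP : IsCompactProjective P)
    (hP' : IsCompactProjective P') (𝓕 : ZSequence F) (𝓕' : ZSequence F')
    (hgen : (ObjectProperty.ofObj fun n => (𝓕.functor n).obj P).IsSeparating)
    (hgen' : (ObjectProperty.ofObj fun n => (𝓕'.functor n).obj P').IsSeparating)
    (h : IsGradedMoritaEquivalent (TwistedEnd.deg 𝓕 P) (TwistedEnd.deg 𝓕' P')) :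
    ∃ G : Autoequivalence k (GrMod 𝒜),
      Nonempty (F.functor ⋙ G.functor ≅ G.functor ⋙ F'.functor) := by
  obtain ⟨Q, hfin, hproj, hsep, e, he⟩ := h
  have : (homFunctor 𝓕 P).IsEquivalence := homFunctor_isEquivalence hP hgen
  let X := (homFunctor 𝓕 P).objPreimage Q
  let i : (homFunctor 𝓕 P).obj X ≅ Q := (homFunctor 𝓕 P).objObjPreimageIso Q
  have hX : IsCompactProjective X :=
    ((isCompactProjective_of_finite hfin (projective_of_projective hproj)).of_iso i.symm).of_map
  have hs : IsSummand 𝓕 P X := isSummand_of_isCompactProjective hX hgen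
  have hgenX := isSeparating_of_isSeparator hs hgen i hsep
  let e' : TwistedEnd 𝓕 X ≃ₐ[k] Module.End (TwistedEnd 𝓕 P)ᵐᵒᵖ Q.carrier :=
    hs.endEquiv.trans ((linEquiv i).conjAlgEquiv k)
  have he' : ∀ n t, t ∈ TwistedEnd.deg 𝓕 X n ↔ e' t ∈ homDeg Q Q n := fun n t =>
    (hs.endEquiv_mem n t).trans (conj_mem_homDeg_iff i n _)
  refine exists_conj_of_algEquiv hX hP' 𝓕 𝓕' hgenX hgen' (e.trans e'.symm) fun n s => ?_
  rw [he, he', AlgEquiv.trans_apply, AlgEquiv.apply_symm_apply]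

end Conjugate

theorem proposition2p9 {k : Type w} [CommRing k] {R : Type u} [Ring R] [Algebra k R]
    (𝒜 : ℤ → Submodule k R) [GradedAlgebra 𝒜]
    (P P' : GrMod 𝒜)
    (hPfin : Module.Finite Rᵐᵒᵖ P.carrier) (hPproj : Projective P)
    (hPfin' : Module.Finite Rᵐᵒᵖ P'.carrier) (hPproj' : Projective P')
    (F F' : Autoequivalence k (GrMod 𝒜))
    (hF : F.IsGenerative P) (hF' : F'.IsGenerative P')
    (𝓕 : ZSequence F) (𝓕' : ZSequence F') :
    IsGradedMoritaEquivalent (TwistedEnd.deg 𝓕 P) (TwistedEnd.deg 𝓕' P') ↔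
      IsConj (Pic.mk F) (Pic.mk F') := by
  have hP := GrMod.isCompactProjective_of_finite hPfin hPproj
  have hP' := GrMod.isCompactProjective_of_finite hPfin' hPproj'
  have hgen := 𝓕.isSeparating_of_isGenerative hF
  have hgen' := 𝓕'.isSeparating_of_isGenerative hF'
  rw [Pic.isConj_mk_iff]
  constructor
  · exact exists_conj_of_isGradedMoritaEquivalent hP hP' 𝓕 𝓕' hgen hgen'
  · rintro ⟨G, ⟨β⟩⟩
    exact isGradedMoritaEquivalent_of_conj hP hP' 𝓕 𝓕' hgen hgen' G β
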